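/- Notation. For integers $r\ge 1$, $w\ge 0$, let $S_w(r)$ be the space of polynomials $f\in\mathbb C[a_1,\dots,a_r]$ with $$f(a_1,\dots,a_r)=f(\gamma(a_1),\dots,\gamma(a_r))\prod_{i=1}^r(Ca_i+D)^w,\qquad \gamma(z)=\frac{Az+B}{Cz+D},$$ for all $\begin{pmatrix}A&B\\C&D\end{pmatrix}\in \mathrm{SL}_2(\mathbb R)$. For a permutation $\sigma$ of $\{1,\dots,r\}$ put $\sigma(f)=f(a_{\sigma(1)},\dots,a_{\sigma(r)})$, and for $T\subseteq\{1,\dots,r\}$ put $\Delta_T=\prod_{i,j\in T,\ i>j}(a_i-a_j)$. For $g\ge 1$ let $B_g=\{1,\dots,2g+2\}$, $U_g=\{1,3,\dots,2g+1\}$, $U_g'=B_g\setminus U_g$, and let $\mathcal S_U$ be the group of permutations $\sigma$ of $B_g$ with $\sigma(U_g)\in\{U_g,U_g'\}$. For $g_1,g_2\ge 1$, $g_1+g_2=g$, and $f\in\mathbb C[a_1,\dots,a_{2g+2}]$, consider $f(a_1,\dots,a_{2g_1+1},\alpha_1+t,\dots,\alpha_{2g_2+1}+t)$ as a polynomial in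 $t$ with coefficients in $\mathbb C[a_1,\dots,a_{2g_1+1}]\otimes\mathbb C[\alpha_1,\dots,\alpha_{2g_2+1}]$; let $\nu_{2g_1+1,2g_2+1}(f)$ be its degree in $t$ and $T^{(m)}_{2g_1+1,2g_2+1}f$ its coefficient of $t^m$. Let $S_w(2g+2)_0$ be the space of $f\in S_w(2g+2)$ such that $f=0$ or $\nu_{2g_1+1,2g_2+1}(f)\le \frac wg(2g_1g_2+g_1+g_2)$ for all $g_1,g_2\ge1$ with $g_1+g_2=g$. For even $k$ let $\mathcal B_g^k$ be the space of $f\in S_{kg/2}(2g+2)_0$ with $\sigma(f)=f$ for all $\sigma\in\mathcal S_U$. The star map $*:S_w(r)\to\mathbb C[a_1,\dots,a_{r-1}]$ sends $f$ to the coefficient of the highest power of $a_r$ in $f$; it is linear and injective on $S_w(r)$. For $g=g_1+g_2$ with $g_1,g_2\ge1$ and $f\in S_{gj}(2g+2)_0$, the value $W_{g_1,g_2}f$ of the Witt map is the (unique, if it exists) element of $S_{g_1j}(2g_1+2)\otimes S_{g_2j}(2g_2+2)$ with $$(*\otimes *)\,W_{g_1,g_2}f=T^{(j(2g_1g_2+g_1+g_2))}_{2g_1+1,2g_2+1}f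 .$$ For $m\ne n$ in $B_g$ and $f\in S_{gj}(2g+2)$ let $$\Phi_{mn}f=\frac{f|_{a_m=a_n=0}}{\prod_{\ell\ne m,n}a_\ell^{\,j}}\in\mathbb C(a_\ell:\ \ell\in B_g\setminus\{m,n\}),$$ and call $f$ a cusp form if $\Phi_{mn}f=0$ for all distinct $m,n\in B_g$. Let $\mathcal E_{2g+2}$ be the set of arrangements $e=(e_1,\dots,e_{2g+2})$ of $1,\dots,2g+2$ with $e_i\equiv i \pmod 2$ for all $i$, and let $$\psi_e=(a_{e_{2g+2}}-a_{e_1})\prod_{i=1}^{2g+1}(a_{e_i}-a_{e_{i+1}}),\qquad H_g=\frac1{2^g}\,\frac1{g+1}\,(\Delta_{B_g})^2\sum_{e\in\mathcal E_{2g+2}}\frac{-1}{\psi_e}\qquad(g\ge1).$$ Theorem. For every $g\ge 1$ the rational function $H_g$ is a polynomial, and: 1. $H_1=\Delta_{B_1}\Delta_{U_1}\Delta_{U_1'}$; 2. $H_g\in\mathcal B_g^8$ for all $g\ge1$; 3. for all $g_1,g_2\ge1$ with $g_1+g_2=g$, $W_{g_1,g_2}H_g$ exists and $W_{g_1,g_2}H_g=H_{g_1}\otimes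 H_{g_2}$; 4. $\sum_{\sigma\in S_{2g+2}}\sigma(H_g)=0$ for all $g\ge 1$, where $S_{2g+2}$ is the group of all permutations of $B_g$; 5. $\Phi_{ij}H_g=0$ for all distinct $i,j\in B_g$ and all $g\ge 1$, i.e. $H_g$ is a cusp form. -/

import Mathlib

open scoped TensorProduct

noncomputable section

namespace BinaryInvariants

/-- The polynomial ring `ℂ[a_1, …, a_r]`; the variable `a_i` is `X` of the index with value `i - 1`. -/
abbrev CPoly (r : ℕ) : Type := MvPolynomial (Fin r) ℂ

/-- The space `S_w(r)` of binary invariants of weight `w` in `r` variables. The transformation law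
is an identity of rational functions in `a_1, …, a_r`; it is imposed at every complex point at which
no denominator `C a_i + D` vanishes. -/
def binaryInvariants (r w : ℕ) : Submodule ℂ (CPoly r) where
  carrier := {f | ∀ M : Matrix.SpecialLinearGroup (Fin 2) ℝ, ∀ a : Fin r → ℂ,
    (∀ i, (M 1 0 : ℂ) * a i + (M 1 1 : ℂ) ≠ 0) →
    MvPolynomial.eval a f =
      MvPolynomial.eval (fun i => ((M 0 0 : ℂ) * a i + (M 0 1 : ℂ)) /
          ((M 1 0 : ℂ) * a i + (M 1 1 : ℂ))) f *
        ∏ i, ((M 1 0 : ℂ) * a i + (M 1 1 : ℂ)) ^ w}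
  add_mem' := by
    intro f g hf hg M a ha
    rw [map_add, map_add, hf M a ha, hg M a ha, add_mul]
  zero_mem' := by
    intro M a _
    simp
  smul_mem' := by
    intro c f hf M a ha
    rw [MvPolynomial.smul_eval, MvPolynomial.smul_eval, hf M a ha, mul_assoc]

/-- The difference product `Δ_T = ∏_{i, j ∈ T, i > j} (a_i - a_j)`. -/
def disc {r : ℕ} (T : Finset (Fin r)) : CPoly r :=
  ∏ p ∈ (T ×ˢ T).filter (fun p => p.2 < p.1), (MvPolynomial.X p.1 - MvPolynomial.X p.2)

/-- `U_g = {1, 3, …, 2g+1}`, a subset of `B_g = {1, …, 2g+2}`. -/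
def oddSet (g : ℕ) : Finset (Fin (2 * g + 2)) :=
  Finset.univ.filter (fun i => Odd (i.val + 1))

/-- The set `𝓔_r` of arrangements `(e_1, …, e_r)` of `1, …, r` with `e_i ≡ i` modulo `2`. -/
def alternating (r : ℕ) : Finset (Equiv.Perm (Fin r)) :=
  Finset.univ.filter (fun e => ∀ i, (e i).val + 1 ≡ i.val + 1 [MOD 2])

/-- `ψ'_e = ∏_{i=1}^{r-1} (a_{e_i} - a_{e_{i+1}})` for a sequence `e` of length `r = n + 1`. -/
def psiOpen {n r : ℕ} (e : Fin (n + 1) → Fin r) : CPoly r :=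
  ∏ i : Fin n, (MvPolynomial.X (e i.castSucc) - MvPolynomial.X (e i.succ))

/-- `ψ_e = (a_{e_r} - a_{e_1}) ψ'_e` for a sequence `e` of length `r = n + 1`. -/
def psi {n r : ℕ} (e : Fin (n + 1) → Fin r) : CPoly r :=
  (MvPolynomial.X (e (Fin.last n)) - MvPolynomial.X (e 0)) * psiOpen e

/-- `H_g`, as an element of the field of rational functions `ℂ(a_1, …, a_{2g+2})`. -/
def H (g : ℕ) : FractionRing (CPoly (2 * g + 2)) :=
  1 / 2 ^ g * (1 / ((g : FractionRing (CPoly (2 * g + 2))) + 1)) *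
    algebraMap (CPoly (2 * g + 2)) _ (disc Finset.univ) ^ 2 *
    ∑ e ∈ alternating (2 * g + 2),
      (-1) / algebraMap (CPoly (2 * g + 2)) (FractionRing (CPoly (2 * g + 2))) (psi e)

/-- The theta group `𝒮_U`: the permutations of `B_g` mapping `U_g` to `U_g` or to its complement. -/
def thetaGroup (g : ℕ) : Subgroup (Equiv.Perm (Fin (2 * g + 2))) where
  carrier := {σ | σ '' (oddSet g : Set (Fin (2 * g + 2))) = oddSet g ∨
    σ '' (oddSet g : Set (Fin (2 * g + 2))) = (oddSet g : Set (Fin (2 * g + 2)))ᶜ}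
  mul_mem' := by
    intro σ τ hσ hτ
    simp only [Set.mem_ofPred_eq, Equiv.Perm.coe_mul, Set.image_comp] at *
    rcases hτ with h | h <;> rcases hσ with h' | h' <;>
      simp [h, h', Set.image_compl_eq σ.bijective]
  one_mem' := by simp
  inv_mem' := by
    intro σ hσ
    simp only [Set.mem_ofPred_eq] at *
    rcases hσ with h | h
    · left
      conv_lhs => rw [← h]
      simp [← Set.image_comp]
    · right
      have h2 : (oddSet g : Set (Fin (2 * g + 2))) =
          σ '' (oddSet g : Set (Fin (2 * g + 2)))ᶜ := by
        rw [Set.image_compl_eq σ.bijective, h, compl_compl]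
      conv_lhs => rw [h2]
      simp [← Set.image_comp]

/-- The substitution `f ↦ f(a_1, …, a_{r₁}, α_1 + t, …, α_{r₂} + t)`, as a polynomial in `t` over
`ℂ[a_1, …, a_{r₁}] ⊗ ℂ[α_1, …, α_{r₂}]`. -/
def pullApart (r₁ r₂ : ℕ) {r : ℕ} (hr : r₁ + r₂ = r) :
    CPoly r →ₐ[ℂ] Polynomial (CPoly r₁ ⊗[ℂ] CPoly r₂) :=
  MvPolynomial.aeval (fun i => Fin.addCases
    (motive := fun _ => Polynomial (CPoly r₁ ⊗[ℂ] CPoly r₂))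
    (fun k : Fin r₁ => Polynomial.C ((MvPolynomial.X k : CPoly r₁) ⊗ₜ[ℂ] (1 : CPoly r₂)))
    (fun k : Fin r₂ => Polynomial.C ((1 : CPoly r₁) ⊗ₜ[ℂ] (MvPolynomial.X k : CPoly r₂)) +
      Polynomial.X)
    (Fin.cast hr.symm i))

/-- The map `T^{(j)}_{r₁,r₂}`: the coefficient of `t ^ j` in
`f(a_1, …, a_{r₁}, α_1 + t, …, α_{r₂} + t)`. -/
def coeffMap (r₁ r₂ : ℕ) {r : ℕ} (hr : r₁ + r₂ = r) (j : ℕ) :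
    CPoly r →ₗ[ℂ] CPoly r₁ ⊗[ℂ] CPoly r₂ where
  toFun f := (pullApart r₁ r₂ hr f).coeff j
  map_add' f g := by simp
  map_smul' c f := by simp

/-- The valuation `ν_{r₁,r₂}`: the degree in `t` of `f(a_1, …, a_{r₁}, α_1 + t, …, α_{r₂} + t)`
(with value `0` at `f = 0`). -/
def splitVal (r₁ r₂ : ℕ) {r : ℕ} (hr : r₁ + r₂ = r) (f : CPoly r) : ℕ :=
  (pullApart r₁ r₂ hr f).natDegree

lemma split_index {g g₁ g₂ : ℕ} (h : g₁ + g₂ = g) :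
    (2 * g₁ + 1) + (2 * g₂ + 1) = 2 * g + 2 := by
  omega

/-- The space `S_w(2g+2)_0` of the binary invariants satisfying the valuation condition. -/
def valInvariants (g w : ℕ) : Submodule ℂ (CPoly (2 * g + 2)) where
  carrier := {f | f ∈ binaryInvariants (2 * g + 2) w ∧
    ∀ (g₁ g₂ : ℕ) (h : g₁ + g₂ = g), 1 ≤ g₁ → 1 ≤ g₂ →
      (splitVal (2 * g₁ + 1) (2 * g₂ + 1) (split_index h) f : ℚ) ≤
        (w : ℚ) / g * (2 * g₁ * g₂ + g₁ + g₂)}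
  add_mem' := by
    rintro f f' ⟨hf, hf2⟩ ⟨hf', hf2'⟩
    refine ⟨add_mem hf hf', fun g₁ g₂ h h₁ h₂ => ?_⟩
    have h3 : splitVal (2 * g₁ + 1) (2 * g₂ + 1) (split_index h) (f + f') ≤
        max (splitVal (2 * g₁ + 1) (2 * g₂ + 1) (split_index h) f)
          (splitVal (2 * g₁ + 1) (2 * g₂ + 1) (split_index h) f') := by
      unfold splitVal
      rw [map_add]
      exact Polynomial.natDegree_add_le _ _
    rcases le_max_iff.mp h3 with h4 | h4
    · exact le_trans (by exact_mod_cast h4) (hf2 g₁ g₂ h h₁ h₂)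
    · exact le_trans (by exact_mod_cast h4) (hf2' g₁ g₂ h h₁ h₂)
  zero_mem' := by
    refine ⟨zero_mem _, fun g₁ g₂ h h₁ h₂ => ?_⟩
    simp only [splitVal, map_zero, Polynomial.natDegree_zero, Nat.cast_zero]
    positivity
  smul_mem' := by
    rintro c f ⟨hf, hf2⟩
    refine ⟨Submodule.smul_mem _ c hf, fun g₁ g₂ h h₁ h₂ => ?_⟩
    refine le_trans ?_ (hf2 g₁ g₂ h h₁ h₂)
    have h3 : splitVal (2 * g₁ + 1) (2 * g₂ + 1) (split_index h) (c • f) ≤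
        splitVal (2 * g₁ + 1) (2 * g₂ + 1) (split_index h) f := by
      unfold splitVal
      rw [AlgHom.map_smul_of_tower]
      exact Polynomial.natDegree_smul_le c _
    exact_mod_cast h3

/-- The space `S_w(2g+2)_0(G)` of elements of `S_w(2g+2)_0` fixed by the group `G` of permutations,
where `σ(f) = f(a_{σ(1)}, …, a_{σ(2g+2)})`. -/
def fixedInvariants (g w : ℕ) (G : Subgroup (Equiv.Perm (Fin (2 * g + 2)))) :
    Submodule ℂ (CPoly (2 * g + 2)) where
  carrier := {f | f ∈ valInvariants g w ∧ ∀ σ ∈ G, MvPolynomial.rename σ f = f}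
  add_mem' := by
    rintro f f' ⟨hf, hf2⟩ ⟨hf', hf2'⟩
    exact ⟨add_mem hf hf', fun σ hσ => by rw [map_add, hf2 σ hσ, hf2' σ hσ]⟩
  zero_mem' := ⟨zero_mem _, fun σ _ => by simp⟩
  smul_mem' := by
    rintro c f ⟨hf, hf2⟩
    exact ⟨Submodule.smul_mem _ c hf, fun σ hσ => by rw [map_smul, hf2 σ hσ]⟩

/-- The space `𝓑_g^k = S_{kg/2}(2g+2)_0(𝒮_U)`, for even `k`. -/
def thetaForms (g k : ℕ) : Submodule ℂ (CPoly (2 * g + 2)) :=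
  fixedInvariants g (g * (k / 2)) (thetaGroup g)

lemma valInvariants_le (g w : ℕ) : valInvariants g w ≤ binaryInvariants (2 * g + 2) w :=
  fun _ hf => hf.1

lemma thetaForms_le (g k : ℕ) : thetaForms g k ≤ valInvariants g (g * (k / 2)) :=
  fun _ hf => hf.1

/-- A polynomial in `a_1, …, a_{n+1}` as a polynomial in `a_{n+1}` over `ℂ[a_1, …, a_n]`. -/
def inLast (n : ℕ) : CPoly (n + 1) →ₐ[ℂ] Polynomial (CPoly n) :=
  MvPolynomial.aeval (fun i => Fin.lastCases (motive := fun _ => Polynomial (CPoly n))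
    Polynomial.X (fun k => Polynomial.C (MvPolynomial.X k)) i)

/-- The star map: the coefficient of the highest power of the last variable. -/
def starMap {n : ℕ} (f : CPoly (n + 1)) : CPoly n := (inLast n f).leadingCoeff

lemma eval_inLast {n : ℕ} (f : CPoly (n + 1)) (b : Fin n → ℂ) (t : ℂ) :
    ((inLast n f).map (MvPolynomial.eval b)).eval t =
      MvPolynomial.eval (Fin.snoc b t : Fin (n + 1) → ℂ) f := by
  have : ((Polynomial.evalRingHom t).comp ((Polynomial.mapRingHom (MvPolynomial.eval b)).comp
      (inLast n).toRingHom)) = MvPolynomial.eval (Fin.snoc b t : Fin (n + 1) → ℂ) := by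
    apply MvPolynomial.ringHom_ext
    · intro c
      simp [inLast]
    · intro i
      refine Fin.lastCases ?_ (fun k => ?_) i <;> simp [inLast]
  exact congrArg (fun φ => φ f) this

lemma coeff_of_inversion (p q : Polynomial ℂ) (c : ℂ) (w : ℕ)
    (h : ∀ t : ℂ, t ≠ 0 → p.eval t = c * q.eval t⁻¹ * t ^ w) :
    (∀ k, w < k → p.coeff k = 0) ∧ p.coeff w = c * q.coeff 0 := by
  have key : p * Polynomial.X ^ q.natDegree =
      Polynomial.C c * q.reverse * Polynomial.X ^ w := by
    apply Polynomial.eq_of_infinite_eval_eq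
    refine Set.Infinite.mono (s := {0}ᶜ) ?_ (Set.finite_singleton (0 : ℂ)).infinite_compl
    intro t ht
    have ht0 : t ≠ 0 := by simpa using ht
    let _ : Invertible t⁻¹ := invertibleOfNonzero (inv_ne_zero ht0)
    have h1 := Polynomial.eval₂_reverse_mul_pow (RingHom.id ℂ) t⁻¹ q
    simp only [Polynomial.eval₂_id, invOf_eq_inv, inv_inv] at h1
    change (p * Polynomial.X ^ q.natDegree).eval t =
      (Polynomial.C c * q.reverse * Polynomial.X ^ w).eval t
    simp only [Polynomial.eval_mul, Polynomial.eval_pow, Polynomial.eval_X, Polynomial.eval_C]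
    rw [h t ht0, ← h1]
    have h2 : t⁻¹ ^ q.natDegree * t ^ q.natDegree = 1 := by
      rw [← mul_pow, inv_mul_cancel₀ ht0, one_pow]
    linear_combination (c * q.reverse.eval t * t ^ w) * h2
  have hk : ∀ k, p.coeff k = (Polynomial.C c * q.reverse * Polynomial.X ^ w).coeff
      (k + q.natDegree) := by
    intro k
    rw [← key, Polynomial.coeff_mul_X_pow]
  constructor
  · intro k hwk
    rw [hk, show k + q.natDegree = (k - w + q.natDegree) + w by omega,
      Polynomial.coeff_mul_X_pow, Polynomial.coeff_C_mul,
      Polynomial.coeff_eq_zero_of_natDegree_lt, mul_zero]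
    exact lt_of_le_of_lt (Polynomial.reverse_natDegree_le q)
      (Nat.lt_add_of_pos_left (Nat.sub_pos_of_lt hwk))
  · rw [hk, add_comm, Polynomial.coeff_mul_X_pow, Polynomial.coeff_C_mul,
      Polynomial.coeff_reverse, Polynomial.revAt_le le_rfl, Nat.sub_self]

lemma coeff_inLast {n w : ℕ} {f : CPoly (n + 1)} (hf : f ∈ binaryInvariants (n + 1) w)
    (b : Fin n → ℂ) (hb : ∀ i, b i ≠ 0) :
    (∀ k, w < k → MvPolynomial.eval b ((inLast n f).coeff k) = 0) ∧
    MvPolynomial.eval b ((inLast n f).coeff w) = (-1) ^ w * (∏ i, (-b i) ^ w) *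
      MvPolynomial.eval (Fin.snoc (fun i => (-b i)⁻¹) 0 : Fin (n + 1) → ℂ) f := by
  have h := coeff_of_inversion ((inLast n f).map (MvPolynomial.eval b))
    (((inLast n f).map (MvPolynomial.eval (fun i => (-b i)⁻¹))).comp (-Polynomial.X))
    ((-1) ^ w * ∏ i, (-b i) ^ w) w ?_
  · obtain ⟨h1, h2⟩ := h
    refine ⟨fun k hk => by simpa using h1 k hk, ?_⟩
    rw [Polynomial.coeff_zero_eq_eval_zero, Polynomial.eval_comp] at h2
    simp only [Polynomial.eval_neg, Polynomial.eval_X, neg_zero, eval_inLast,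
      Polynomial.coeff_map] at h2
    exact h2
  · intro t ht
    rw [Polynomial.eval_comp]
    simp only [Polynomial.eval_neg, Polynomial.eval_X, eval_inLast]
    let M : Matrix.SpecialLinearGroup (Fin 2) ℝ :=
      ⟨!![0, 1; -1, 0], by simp [Matrix.det_fin_two_of]⟩
    have h := hf M (Fin.snoc b t) (by
      intro i
      refine Fin.lastCases ?_ (fun k => ?_) i
      · simpa [M] using ht
      · simpa [M] using hb k)
    rw [h, Fin.prod_univ_castSucc]
    have e1 : (fun i => ((M 0 0 : ℂ) * (Fin.snoc b t : Fin (n + 1) → ℂ) i + (M 0 1 : ℂ)) /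
          ((M 1 0 : ℂ) * (Fin.snoc b t : Fin (n + 1) → ℂ) i + (M 1 1 : ℂ))) =
        (Fin.snoc (fun i => (-b i)⁻¹) (-t⁻¹) : Fin (n + 1) → ℂ) := by
      funext i
      refine Fin.lastCases ?_ (fun k => ?_) i
      · simp [M, div_eq_mul_inv, inv_neg]
      · simp [M, div_eq_mul_inv, inv_neg]
    rw [e1]
    simp [M]
    rw [neg_pow t]
    ring

/-- A polynomial vanishing at all real points with distinct coordinates away from a nonzero
polynomial is zero. -/
lemma eq_zero_of_mul {n : ℕ} (f d : CPoly n) (hd : d ≠ 0)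
    (h : ∀ x : Fin n → ℝ, MvPolynomial.eval (fun i => (x i : ℂ)) d ≠ 0 →
      MvPolynomial.eval (fun i => (x i : ℂ)) f = 0) : f = 0 := by
  have h0 : f * d = 0 := by
    refine MvPolynomial.funext_set (fun _ => Set.range (fun x : ℝ => (x : ℂ)))
      (fun _ => Set.infinite_range_of_injective Complex.ofReal_injective) ?_
    intro z hz
    choose x hx using fun i => hz i (Set.mem_univ i)
    obtain rfl : (fun i => (x i : ℂ)) = z := funext hx
    rw [map_mul, map_zero]
    by_cases hdx : MvPolynomial.eval (fun i => (x i : ℂ)) d = 0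
    · rw [hdx, mul_zero]
    · rw [h x hdx, zero_mul]
  exact (mul_eq_zero.mp h0).resolve_right hd

lemma coeff_inLast_eq_zero {n w : ℕ} {f : CPoly (n + 1)} (hf : f ∈ binaryInvariants (n + 1) w)
    {k : ℕ} (hk : w < k) : (inLast n f).coeff k = 0 := by
  refine eq_zero_of_mul _ (∏ i, MvPolynomial.X i)
    (Finset.prod_ne_zero_iff.mpr fun i _ => MvPolynomial.X_ne_zero i) ?_
  intro x hx
  simp only [map_prod, MvPolynomial.eval_X, Finset.prod_ne_zero_iff] at hx
  exact (coeff_inLast hf _ (fun i => hx i (Finset.mem_univ i))).1 k hk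

lemma eq_zero_of_coeff {n w : ℕ} {f : CPoly (n + 1)} (hf : f ∈ binaryInvariants (n + 1) w)
    (h0 : (inLast n f).coeff w = 0) : f = 0 := by
  refine eq_zero_of_mul _ (∏ i : Fin n,
    (MvPolynomial.X i.castSucc - MvPolynomial.X (Fin.last n))) ?_ ?_
  · refine Finset.prod_ne_zero_iff.mpr fun i _ => sub_ne_zero.mpr fun h => ?_
    exact (Fin.castSucc_lt_last i).ne (MvPolynomial.X_injective h)
  intro x hx
  simp only [map_prod, map_sub, MvPolynomial.eval_X, Finset.prod_ne_zero_iff, Finset.mem_univ,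
    true_implies] at hx
  let b : Fin n → ℂ := fun i => -((x i.castSucc : ℂ) - x (Fin.last n))⁻¹
  have hb : ∀ i, b i ≠ 0 := fun i => neg_ne_zero.mpr (inv_ne_zero (hx i))
  have h1 := (coeff_inLast hf b hb).2
  rw [h0, map_zero] at h1
  have h2 := (mul_eq_zero.mp h1.symm).resolve_left (mul_ne_zero (pow_ne_zero _ (by norm_num))
    (Finset.prod_ne_zero_iff.mpr fun i _ => pow_ne_zero _ (neg_ne_zero.mpr (hb i))))
  let M : Matrix.SpecialLinearGroup (Fin 2) ℝ :=
    ⟨!![1, -x (Fin.last n); 0, 1], by simp [Matrix.det_fin_two_of]⟩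
  rw [hf M _ (by intro i; simp [M])]
  have e1 : (fun i => ((M 0 0 : ℂ) * (x i : ℂ) + (M 0 1 : ℂ)) /
        ((M 1 0 : ℂ) * (x i : ℂ) + (M 1 1 : ℂ))) =
      (Fin.snoc (fun i => (-b i)⁻¹) 0 : Fin (n + 1) → ℂ) := by
    funext i
    refine Fin.lastCases ?_ (fun k => ?_) i
    · simp [M]
    · simp [M, b, sub_eq_add_neg]
  rw [e1, h2, zero_mul]

lemma starMap_eq_coeff {n w : ℕ} {f : CPoly (n + 1)} (hf : f ∈ binaryInvariants (n + 1) w) :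
    starMap f = (inLast n f).coeff w := by
  by_cases h0 : (inLast n f).coeff w = 0
  · rw [eq_zero_of_coeff hf h0]
    simp [starMap]
  · have : (inLast n f).natDegree = w := le_antisymm
      (Polynomial.natDegree_le_iff_coeff_eq_zero.mpr fun k hk => coeff_inLast_eq_zero hf hk)
      (Polynomial.le_natDegree_of_ne_zero h0)
    rw [starMap, Polynomial.leadingCoeff, this]

/-- The star map on `S_w(n+1)`, where it is linear. -/
def starLinear (n w : ℕ) : binaryInvariants (n + 1) w →ₗ[ℂ] CPoly n where
  toFun f := starMap (f : CPoly (n + 1))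
  map_add' f f' := by
    rw [starMap_eq_coeff (f + f').2, starMap_eq_coeff f.2, starMap_eq_coeff f'.2]
    simp
  map_smul' c f := by
    rw [starMap_eq_coeff (c • f).2, starMap_eq_coeff f.2]
    simp

/-- The map `* ⊗ *` on `S_{g₁ j}(2g₁+2) ⊗ S_{g₂ j}(2g₂+2)`. -/
def starTensor (g₁ g₂ j : ℕ) :
    binaryInvariants (2 * g₁ + 2) (g₁ * j) ⊗[ℂ] binaryInvariants (2 * g₂ + 2) (g₂ * j) →ₗ[ℂ]
      CPoly (2 * g₁ + 1) ⊗[ℂ] CPoly (2 * g₂ + 1) :=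
  TensorProduct.map (starLinear (2 * g₁ + 1) (g₁ * j)) (starLinear (2 * g₂ + 1) (g₂ * j))

/-- The equation `(* ⊗ *) x = T^{(j(2g₁g₂+g₁+g₂))}_{2g₁+1,2g₂+1} f`, which characterizes the value
`x = W_{g₁,g₂} f` of the Witt map. -/
def IsWittImage (g₁ g₂ j : ℕ) (f : valInvariants (g₁ + g₂) ((g₁ + g₂) * j))
    (x : binaryInvariants (2 * g₁ + 2) (g₁ * j) ⊗[ℂ] binaryInvariants (2 * g₂ + 2) (g₂ * j)) :
    Prop :=
  starTensor g₁ g₂ j x =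
    coeffMap (2 * g₁ + 1) (2 * g₂ + 1) (split_index rfl) (j * (2 * g₁ * g₂ + g₁ + g₂))
      (f : CPoly (2 * (g₁ + g₂) + 2))

open Classical in
/-- The Witt map `W_{g₁,g₂}` on `S_{gj}(2g+2)_0`, `g = g₁ + g₂`: its value at `f` is the unique `x`
in `S_{g₁ j}(2g₁+2) ⊗ S_{g₂ j}(2g₂+2)` with `IsWittImage g₁ g₂ j f x`
(and `0` where there is no such element). -/
def wittMap (g₁ g₂ j : ℕ) (f : valInvariants (g₁ + g₂) ((g₁ + g₂) * j)) :
    binaryInvariants (2 * g₁ + 2) (g₁ * j) ⊗[ℂ] binaryInvariants (2 * g₂ + 2) (g₂ * j) :=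
  if h : ∃! x, IsWittImage g₁ g₂ j f x then h.choose else 0

/-- The substitution `a_m = 0 = a_n`, with values in the polynomials in the other variables. -/
def phiBar {r : ℕ} (m n : Fin r) : CPoly r →ₐ[ℂ] MvPolynomial {l : Fin r // l ≠ m ∧ l ≠ n} ℂ :=
  MvPolynomial.aeval (fun l => if h : l ≠ m ∧ l ≠ n then MvPolynomial.X ⟨l, h⟩ else 0)

/-- `Φ_{mn} f = f|_{a_m = 0 = a_n} / (∏_{l ≠ m, n} a_l) ^ j` for `f ∈ S_{gj}(2g+2)`, as a rational
function of the variables other than `a_m` and `a_n`. -/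
def phi {g j : ℕ} (m n : Fin (2 * g + 2)) (f : binaryInvariants (2 * g + 2) (g * j)) :
    FractionRing (MvPolynomial {l : Fin (2 * g + 2) // l ≠ m ∧ l ≠ n} ℂ) :=
  algebraMap (MvPolynomial {l : Fin (2 * g + 2) // l ≠ m ∧ l ≠ n} ℂ) _
      (phiBar m n (f : CPoly (2 * g + 2))) /
    algebraMap (MvPolynomial {l : Fin (2 * g + 2) // l ≠ m ∧ l ≠ n} ℂ) _
      (∏ l, MvPolynomial.X l) ^ j

/-- Cusp forms: the elements `f` of `S_{gj}(2g+2)` with `Φ_{mn} f = 0` for all distinct `m, n`. -/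
def IsCuspForm {g j : ℕ} (f : binaryInvariants (2 * g + 2) (g * j)) : Prop :=
  ∀ m n : Fin (2 * g + 2), m ≠ n → phi m n f = 0

/-- The inclusion of `𝓑_g^k` in `S_{kg/2}(2g+2)_0`. -/
def toValInvariants {g k : ℕ} : thetaForms g k →ₗ[ℂ] valInvariants g (g * (k / 2)) :=
  Submodule.inclusion (thetaForms_le g k)

/-- The inclusion of `𝓑_g^k` in `S_{kg/2}(2g+2)`. -/
def toBinaryInvariants {g k : ℕ} :
    thetaForms g k →ₗ[ℂ] binaryInvariants (2 * g + 2) (g * (k / 2)) :=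
  Submodule.inclusion ((thetaForms_le g k).trans (valInvariants_le g (g * (k / 2))))

end BinaryInvariants

end

open BinaryInvariants

/-!
The reciprocal of `ψ_e` is a cyclic product, and the whole theorem is read off from the complement
of a cycle. Up to the sign `(-1) ^ (g + 1)`, the square `Δ²` is the product of all differences
`a_i - a_j` over ordered pairs of distinct indices; since `ψ_e` is the product over the pairs of
consecutive entries of the cycle `e`, the quotient `Δ² / ψ_e` is, up to that sign, the product over
the remaining ordered pairs. It is the translate by `e` of a single polynomial `cycleCofactor`, so
`H_g` is a constant times `∑_e rename e cycleCofactor` (`polyH`, `algebraMap_polyH`).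

* Each index occurs in `2 (r - 2) = 4 g` of the remaining pairs, which gives the weight
  (`cycleCofactor_mem`). A permutation in the theta group preserves or exchanges the two parity
  classes; in the second case composing with a rotation of the cycle restores the condition on
  parities, so the sum is invariant (`rename_polyH`).
* A cycle of length at least three never runs through an edge in both directions, so
  `a_m - a_n` or `a_n - a_m` remains as a factor and `H_g` is a cusp form (`phiBar_polyH`).
* The sum of `1 / ψ_σ` over all arrangements `σ` telescopes under the rotations that fix one entry
  (`sum_perm_inv_cyclic_prod`).
* When `2b + 1` of the variables are translated by `t`, a cycle that runs `2k` times between the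
  fixed and the moving variables contributes degree `2 (2a + 1)(2b + 1) - 2k`. Here `k ≥ 1`, and this
  is the valuation condition. For `k = 1` exactly one rotation of the cycle lists the fixed variables
  before the moving ones; it is an even rotation because of parities, and the cofactor then
  degenerates into a product of cofactors of two Hamiltonian paths. Counting the `g + 1` even
  rotations cancels the denominator `g + 1` (`sum_alternating_eq_sum_split`,
  `coeff_pullFrom_polyH`). The star map is the case of one moving variable, so the extremal
  coefficient of `H_{a+b}` is the tensor product of the images of `H_a` and `H_b` under the star map
  (`coeffMap_polyH`). Uniqueness in the definition of the Witt map follows since the star map, and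
  hence the tensor product of two star maps, is injective.
-/

open scoped TensorProduct

noncomputable section

namespace BinaryInvariants

open MvPolynomial

/-! ### Products of differences indexed by a relation -/

/-- The product of the differences `a_i - a_j` over all ordered pairs `(i, j)` with `R i j`. -/
def diffProd {r : ℕ} (R : Fin r → Fin r → Prop) [DecidableRel R] : CPoly r :=
  ∏ i, ∏ j, if R i j then X i - X j else 1

/-- The complement of a Hamiltonian cycle: the product of `a_i - a_j` over the ordered pairs of
distinct indices such that `j` is not the cyclic successor of `i`. Its translates by permutations
are, up to one common sign, the polynomials `Δ² / ψ_e`. -/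
def cycleCofactor (r : ℕ) : CPoly r := diffProd fun i j => i ≠ j ∧ j ≠ finRotate r i

/-- The complement of a Hamiltonian path: the product of `a_i - a_j` over the ordered pairs of
distinct indices with `j ≠ i + 1`, without wrapping around. -/
def pathCofactor (r : ℕ) : CPoly r :=
  diffProd fun i j => i ≠ j ∧ (j : ℕ) ≠ (i : ℕ) + 1

lemma aeval_diffProd {r : ℕ} {A : Type*} [CommRing A] [Algebra ℂ A] (R : Fin r → Fin r → Prop)
    [DecidableRel R] (v : Fin r → A) :
    aeval v (diffProd R) = ∏ i, ∏ j, if R i j then v i - v j else 1 := by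
  simp only [diffProd, map_prod]
  refine Finset.prod_congr rfl fun i _ => Finset.prod_congr rfl fun j _ => ?_
  split_ifs <;> simp

lemma rename_diffProd {r : ℕ} (σ : Equiv.Perm (Fin r)) (R : Fin r → Fin r → Prop)
    [DecidableRel R] (hR : ∀ i j, R (σ i) (σ j) ↔ R i j) :
    rename σ (diffProd R) = diffProd R := by
  rw [rename_eq_aeval, aeval_diffProd, diffProd]
  refine Eq.trans ?_ (Equiv.prod_comp σ _)
  refine Finset.prod_congr rfl fun i _ => ?_
  refine Eq.trans ?_ (Equiv.prod_comp σ _)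
  exact Finset.prod_congr rfl fun j _ => if_congr (hR i j).symm rfl rfl

lemma coe_finRotate {r : ℕ} (i : Fin r) : (finRotate r i : ℕ) = (i + 1) % r := by
  cases r with
  | zero => exact i.elim0
  | succ n =>
    rw [finRotate_apply, Fin.val_add]
    cases n <;> simp

lemma finRotate_ne {n : ℕ} (i : Fin (n + 2)) : finRotate (n + 2) i ≠ i := by
  rw [finRotate_apply]
  simp

lemma finRotate_finRotate_ne {n : ℕ} (i : Fin (n + 3)) :
    finRotate (n + 3) (finRotate (n + 3) i) ≠ i := by
  intro h
  have h1 := congrArg Fin.val h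
  simp only [coe_finRotate, Nat.mod_add_mod] at h1
  have h2 := i.2
  rcases lt_or_ge ((i : ℕ) + 1 + 1) (n + 3) with h3 | h3
  · rw [Nat.mod_eq_of_lt h3] at h1
    omega
  · rw [Nat.mod_eq_sub_mod h3, Nat.mod_eq_of_lt (by omega)] at h1
    omega

/-! ### The polynomial form of `H_g` -/

lemma psi_eq_prod {n r : ℕ} (e : Fin (n + 1) → Fin r) :
    psi e = ∏ i, (X (e i) - X (e (finRotate (n + 1) i))) := by
  rw [Fin.prod_univ_castSucc, psi, psiOpen, mul_comm]
  simp

/-- Every `ψ_e` divides the product of all differences, with quotient a translate of one fixed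
polynomial. -/
lemma psi_mul_cycleCofactor {n : ℕ} (e : Equiv.Perm (Fin (n + 2))) :
    psi e * rename e (cycleCofactor (n + 2)) = diffProd (· ≠ ·) := by
  have h1 : psi e = rename e (psi (id : Fin (n + 2) → Fin (n + 2))) := by
    simp [psi_eq_prod, map_prod]
  rw [← rename_diffProd e (· ≠ ·) (fun i j => e.injective.ne_iff), h1, ← map_mul, psi_eq_prod,
    cycleCofactor]
  congr 1
  simp only [diffProd, id]
  rw [← Finset.prod_mul_distrib]
  refine Finset.prod_congr rfl fun i _ => ?_
  have h2 : (X i - X (finRotate (n + 2) i) : CPoly (n + 2)) =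
      ∏ j, if j = finRotate (n + 2) i then X i - X j else 1 := by
    rw [Finset.prod_ite_eq' Finset.univ (finRotate (n + 2) i), if_pos (Finset.mem_univ _)]
  refine (congrArg (· * _) h2).trans ?_
  rw [← Finset.prod_mul_distrib]
  refine Finset.prod_congr rfl fun j _ => ?_
  have h3 := finRotate_ne i
  by_cases hj : j = finRotate (n + 2) i
  · subst hj
    simp [h3.symm, -finRotate_apply]
  · simp [hj, -finRotate_apply]

lemma card_lt_pairs (r : ℕ) :
    2 * ((Finset.univ ×ˢ Finset.univ : Finset (Fin r × Fin r)).filter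
      (fun p => p.2 < p.1)).card = r * (r - 1) := by
  have h : ((Finset.univ ×ˢ Finset.univ : Finset (Fin r × Fin r)).filter
      (fun p => p.2 < p.1)).card = ∑ i : Fin r, (i : ℕ) := by
    rw [Finset.card_filter, Finset.sum_product]
    refine Finset.sum_congr rfl fun i _ => ?_
    rw [← Finset.card_filter, Finset.filter_gt_eq_Iio, Fin.card_Iio]
  rw [h, Fin.sum_univ_eq_sum_range (fun i => i), mul_comm, Finset.sum_range_id_mul_two]

lemma diffProd_ne_eq_disc_sq (g : ℕ) :
    diffProd (r := 2 * g + 2) (· ≠ ·) = (-1) ^ (g + 1) * disc Finset.univ ^ 2 := by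
  set s := (Finset.univ ×ˢ Finset.univ : Finset (Fin (2 * g + 2) × Fin (2 * g + 2))).filter
      (fun p => p.2 < p.1) with hs
  have hc : s.card = (g + 1) * (2 * g + 1) := by
    have h1 : 2 * s.card = _ := card_lt_pairs (2 * g + 2)
    rw [show 2 * g + 2 - 1 = 2 * g + 1 by omega] at h1
    have h2 : (2 * g + 2) * (2 * g + 1) = 2 * ((g + 1) * (2 * g + 1)) := by ring
    exact Nat.eq_of_mul_eq_mul_left two_pos (h1.trans h2)
  have hsign : ((-1) ^ s.card : CPoly (2 * g + 2)) = (-1) ^ (g + 1) := by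
    rw [hc, mul_comm (g + 1), pow_mul, Odd.neg_one_pow (n := 2 * g + 1) ⟨g, rfl⟩]
  have hflip : disc Finset.univ = (-1) ^ (g + 1) *
      ∏ p ∈ s, (X p.2 - X p.1 : CPoly (2 * g + 2)) := by
    rw [← hsign, ← Finset.prod_const, ← Finset.prod_mul_distrib]
    exact Finset.prod_congr rfl fun p _ => by ring
  have hdiff : diffProd (r := 2 * g + 2) (· ≠ ·) =
      disc Finset.univ * ∏ p ∈ s, (X p.2 - X p.1 : CPoly (2 * g + 2)) := by
    have h1 : disc Finset.univ = ∏ i : Fin (2 * g + 2), ∏ j : Fin (2 * g + 2),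
        if j < i then (X i - X j : CPoly (2 * g + 2)) else 1 := by
      rw [disc, Finset.prod_filter, Finset.prod_product]
    have h2 : ∏ p ∈ s, (X p.2 - X p.1 : CPoly (2 * g + 2)) =
        ∏ i : Fin (2 * g + 2), ∏ j : Fin (2 * g + 2),
          if i < j then (X i - X j : CPoly (2 * g + 2)) else 1 := by
      rw [hs, Finset.prod_filter, Finset.prod_product, Finset.prod_comm]
    rw [h1, h2, ← Finset.prod_mul_distrib]
    refine Finset.prod_congr rfl fun i _ => ?_
    rw [← Finset.prod_mul_distrib]
    refine Finset.prod_congr rfl fun j _ => ?_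
    rcases lt_trichotomy i j with h | h | h
    · simp [h, h.ne, h.asymm]
    · simp [h]
    · simp [h, h.ne', h.asymm]
  have hone : ((-1) ^ (g + 1) * (-1) ^ (g + 1) : CPoly (2 * g + 2)) = 1 := by
    rw [← mul_pow]
    simp
  rw [hdiff]
  linear_combination (-(-1) ^ (g + 1) * disc Finset.univ) * hflip -
    (disc Finset.univ * ∏ p ∈ s, (X p.2 - X p.1 : CPoly (2 * g + 2))) * hone

lemma diffProd_ne_zero {r : ℕ} (R : Fin r → Fin r → Prop) [DecidableRel R]
    (hR : ∀ i, ¬ R i i) : diffProd R ≠ 0 := by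
  refine Finset.prod_ne_zero_iff.mpr fun i _ => Finset.prod_ne_zero_iff.mpr fun j _ => ?_
  split_ifs with h
  · refine sub_ne_zero.mpr fun h1 => ?_
    obtain rfl := X_injective h1
    exact hR i h
  · exact one_ne_zero

/-- The polynomial form of `H_g`. -/
def polyH (g : ℕ) : CPoly (2 * g + 2) :=
  C ((-1 / 2 : ℂ) ^ g / (g + 1)) *
    ∑ e ∈ alternating (2 * g + 2), rename e (cycleCofactor (2 * g + 2))

lemma algebraMap_polyH (g : ℕ) :
    algebraMap (CPoly (2 * g + 2)) (FractionRing (CPoly (2 * g + 2))) (polyH g) = H g := by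
  set φ := algebraMap (CPoly (2 * g + 2)) (FractionRing (CPoly (2 * g + 2))) with hφ
  have hterm : ∀ e : Equiv.Perm (Fin (2 * g + 2)),
      φ (disc Finset.univ) ^ 2 * (-1 / φ (psi e)) =
        (-1) ^ g * φ (rename e (cycleCofactor (2 * g + 2))) := by
    intro e
    have h1 := (psi_mul_cycleCofactor e).trans (diffProd_ne_eq_disc_sq g)
    have h2 : φ (psi e) ≠ 0 := by
      intro h
      have h3 : psi e = 0 := IsFractionRing.injective _ _ (h.trans (map_zero φ).symm)
      refine diffProd_ne_zero (r := 2 * g + 2) (· ≠ ·) (fun i => by simp) ?_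
      rw [← psi_mul_cycleCofactor e, h3, zero_mul]
    have h4 := congrArg φ h1
    simp only [map_mul, map_pow, map_neg, map_one] at h4
    have h5 : ((-1) ^ g * (-1) ^ g : FractionRing (CPoly (2 * g + 2))) = 1 := by
      rw [← mul_pow]
      simp
    rw [mul_div_assoc', div_eq_iff h2]
    linear_combination -(-1) ^ g * h4 + φ (disc Finset.univ) ^ 2 * h5
  have hC : φ (C ((-1 / 2 : ℂ) ^ g / (g + 1))) = (-1) ^ g * (1 / 2 ^ g * (1 / (g + 1))) := by
    have h1 : φ.comp C ((-1 / 2 : ℂ) ^ g / (g + 1)) =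
        (-1) ^ g * (1 / 2 ^ g * (1 / (g + 1))) := by
      rw [map_div₀, map_pow, map_div₀]
      simp only [map_neg, map_one, map_ofNat, map_add, map_natCast]
      rw [div_pow]
      ring
    exact h1
  have hsum : φ (disc Finset.univ) ^ 2 *
      ∑ e ∈ alternating (2 * g + 2), (-1) / φ (psi e) =
      (-1) ^ g * φ (∑ e ∈ alternating (2 * g + 2), rename e (cycleCofactor (2 * g + 2))) := by
    rw [map_sum, Finset.mul_sum, Finset.mul_sum]
    exact Finset.sum_congr rfl fun e _ => hterm e
  rw [polyH, map_mul, hC, H, mul_assoc _ (_ ^ 2), hsum]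
  ring

/-! ### Invariance under Möbius transformations -/

lemma prod_ite_row {r : ℕ} {A : Type*} [CommRing A] {i k : Fin r} (hk : k ≠ i) (x : A) :
    (∏ j, if i ≠ j ∧ j ≠ k then x else 1) = x ^ (r - 2) := by
  rw [Finset.prod_ite, Finset.prod_const_one, mul_one, Finset.prod_const]
  congr 1
  have h : (Finset.univ.filter fun j => i ≠ j ∧ j ≠ k) = ({i, k} : Finset (Fin r))ᶜ := by
    ext j
    simp [eq_comm]
  rw [h, Finset.card_compl, Fintype.card_fin, Finset.card_pair hk.symm]

/-- In the cofactor of a Hamiltonian cycle every index occurs `r - 2` times as a first and `r - 2`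
times as a second member of a pair. -/
lemma prod_mul_cycle_pairs {r : ℕ} {A : Type*} [CommRing A] (hr : 2 ≤ r) (l : Fin r → A) :
    (∏ i, ∏ j, if i ≠ j ∧ j ≠ finRotate r i then l i * l j else 1) =
      ∏ i, l i ^ (2 * (r - 2)) := by
  obtain ⟨n, rfl⟩ := Nat.exists_eq_add_of_le' hr
  have h1 : ∀ i j, (if i ≠ j ∧ j ≠ finRotate (n + 2) i then l i * l j else 1) =
      (if i ≠ j ∧ j ≠ finRotate (n + 2) i then l i else 1) *
      (if i ≠ j ∧ j ≠ finRotate (n + 2) i then l j else 1) := by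
    intro i j
    split_ifs <;> simp
  simp only [h1, Finset.prod_mul_distrib]
  rw [Finset.prod_comm (f := fun i j => if i ≠ j ∧ j ≠ finRotate (n + 2) i then l j else 1),
    ← Finset.prod_mul_distrib]
  refine Finset.prod_congr rfl fun i _ => ?_
  rw [prod_ite_row (finRotate_ne i)]
  have h2 : ∀ j, (i ≠ j ∧ j ≠ (finRotate (n + 2)).symm i) ↔
      (j ≠ i ∧ i ≠ finRotate (n + 2) j) := by
    intro j
    rw [ne_comm (a := i) (b := j)]
    refine and_congr Iff.rfl (not_congr ?_)
    rw [Equiv.eq_symm_apply]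
    exact eq_comm
  have h3 : (finRotate (n + 2)).symm i ≠ i := by
    intro h
    rw [Equiv.symm_apply_eq] at h
    exact finRotate_ne i h.symm
  have h4 := prod_ite_row h3 (l i)
  simp only [h2] at h4
  rw [h4, ← pow_add, two_mul]

lemma cycleCofactor_mem {r : ℕ} (hr : 2 ≤ r) :
    cycleCofactor r ∈ binaryInvariants r (2 * (r - 2)) := by
  intro M a ha
  rw [← prod_mul_cycle_pairs hr, ← coe_aeval_eq_eval, ← coe_aeval_eq_eval, cycleCofactor]
  simp only [RingHom.coe_coe]
  rw [aeval_diffProd, aeval_diffProd, ← Finset.prod_mul_distrib]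
  refine Finset.prod_congr rfl fun i _ => ?_
  rw [← Finset.prod_mul_distrib]
  refine Finset.prod_congr rfl fun j _ => ?_
  split_ifs with h
  · have hdet : (M 0 0 : ℂ) * M 1 1 - M 0 1 * M 1 0 = 1 := by
      have := M.det_coe
      rw [Matrix.det_fin_two] at this
      exact_mod_cast this
    have h1 := ha i
    have h2 := ha j
    rw [div_sub_div _ _ h1 h2, div_mul_cancel₀ _ (mul_ne_zero h1 h2)]
    linear_combination (a j - a i) * hdet
  · simp

lemma rename_mem_binaryInvariants {r w : ℕ} (σ : Equiv.Perm (Fin r)) {f : CPoly r}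
    (hf : f ∈ binaryInvariants r w) : rename σ f ∈ binaryInvariants r w := by
  intro M a ha
  rw [eval_rename, eval_rename, hf M (a ∘ σ) fun i => ha (σ i)]
  congr 1
  exact Equiv.prod_comp σ fun i => ((M 1 0 : ℂ) * a i + (M 1 1 : ℂ)) ^ w

lemma polyH_mem_binaryInvariants (g : ℕ) : polyH g ∈ binaryInvariants (2 * g + 2) (g * 4) := by
  rw [polyH, C_mul']
  refine Submodule.smul_mem _ _ (Submodule.sum_mem _ fun e _ => rename_mem_binaryInvariants e ?_)
  have h := cycleCofactor_mem (r := 2 * g + 2) (by omega)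
  rwa [show 2 * (2 * g + 2 - 2) = g * 4 by omega] at h

/-! ### Vanishing at the cusps -/

/-- A Hamiltonian cycle on at least three vertices does not traverse an edge in both directions, so
for all `m ≠ n` one of the factors `a_m - a_n`, `a_n - a_m` remains in the cofactor. -/
lemma phiBar_rename_cycleCofactor {k : ℕ} (e : Equiv.Perm (Fin (k + 3))) {m n : Fin (k + 3)}
    (hmn : m ≠ n) : phiBar m n (rename e (cycleCofactor (k + 3))) = 0 := by
  rw [phiBar, aeval_rename, cycleCofactor, aeval_diffProd]
  have hzero : ∀ i j, i ≠ j → j ≠ finRotate (k + 3) i →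
      (e i = m ∨ e i = n) → (e j = m ∨ e j = n) →
      (∏ i, ∏ j, if i ≠ j ∧ j ≠ finRotate (k + 3) i then
        ((fun l => if h : l ≠ m ∧ l ≠ n then X ⟨l, h⟩ else 0) ∘ e :
          _ → MvPolynomial {l : Fin (k + 3) // l ≠ m ∧ l ≠ n} ℂ) i -
        ((fun l => if h : l ≠ m ∧ l ≠ n then X ⟨l, h⟩ else 0) ∘ e) j else 1) = 0 := by
    intro i j hij hj hi hj'
    refine Finset.prod_eq_zero (Finset.mem_univ i) (Finset.prod_eq_zero (Finset.mem_univ j) ?_)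
    rw [if_pos ⟨hij, hj⟩]
    have h1 : ¬ (e i ≠ m ∧ e i ≠ n) := by tauto
    have h2 : ¬ (e j ≠ m ∧ e j ≠ n) := by tauto
    simp only [Function.comp_apply]
    rw [dif_neg h1, dif_neg h2, sub_zero]
  by_cases h : e.symm n = finRotate (k + 3) (e.symm m)
  · refine hzero (e.symm n) (e.symm m) (by simpa using hmn.symm) ?_ (by simp) (by simp)
    rw [h]
    exact (finRotate_finRotate_ne _).symm
  · exact hzero (e.symm m) (e.symm n) (by simpa using hmn) h (by simp) (by simp)

lemma phiBar_polyH {g : ℕ} (hg : 1 ≤ g) {m n : Fin (2 * g + 2)} (hmn : m ≠ n) :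
    phiBar m n (polyH g) = 0 := by
  obtain ⟨k, rfl⟩ := Nat.exists_eq_add_of_le' hg
  rw [polyH, map_mul, map_sum, Finset.sum_eq_zero, mul_zero]
  intro e _
  exact phiBar_rename_cycleCofactor (k := 2 * k + 1) e hmn

/-! ### Invariance under the theta group -/

lemma mem_alternating {r : ℕ} {e : Equiv.Perm (Fin r)} :
    e ∈ alternating r ↔ ∀ i, (e i : ℕ) % 2 = (i : ℕ) % 2 := by
  rw [alternating, Finset.mem_filter, and_iff_right (Finset.mem_univ e)]
  simp only [Nat.ModEq]
  exact forall_congr' fun i => by omega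

lemma rename_addRight_cycleCofactor {r : ℕ} [NeZero r] (m : Fin r) :
    rename (Equiv.addRight m) (cycleCofactor r) = cycleCofactor r := by
  refine rename_diffProd _ _ fun i j => ?_
  have h : finRotate r (Equiv.addRight m i) = Equiv.addRight m (finRotate r i) := by
    simp [add_right_comm]
  rw [h, (Equiv.addRight m).injective.ne_iff, (Equiv.addRight m).injective.ne_iff]

lemma rename_mul_addRight_cycleCofactor {r : ℕ} [NeZero r] (e : Equiv.Perm (Fin r)) (m : Fin r) :
    rename (e * Equiv.addRight m : Equiv.Perm (Fin r)) (cycleCofactor r) =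
      rename e (cycleCofactor r) := by
  rw [Equiv.Perm.coe_mul, ← rename_rename, rename_addRight_cycleCofactor]

lemma mem_oddSet {g : ℕ} {i : Fin (2 * g + 2)} : i ∈ oddSet g ↔ (i : ℕ) % 2 = 0 := by
  simp only [oddSet, Finset.mem_filter, Finset.mem_univ, true_and, Nat.odd_iff]
  omega

lemma parity_of_mem_thetaGroup {g : ℕ} {σ : Equiv.Perm (Fin (2 * g + 2))}
    (hσ : σ ∈ thetaGroup g) :
    (∀ i, (σ i : ℕ) % 2 = (i : ℕ) % 2) ∨ ∀ i, (σ i : ℕ) % 2 = ((i : ℕ) + 1) % 2 := by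
  refine hσ.imp (fun h i => ?_) fun h i => ?_
  · have h1 := (σ.injective.mem_set_image (s := (oddSet g : Set _)) (a := i))
    rw [h, Finset.mem_coe, Finset.mem_coe, mem_oddSet, mem_oddSet] at h1
    omega
  · have h1 := (σ.injective.mem_set_image (s := (oddSet g : Set _)) (a := i))
    rw [h, Set.mem_compl_iff, Finset.mem_coe, Finset.mem_coe, mem_oddSet, mem_oddSet] at h1
    omega

lemma val_add_mod_two {g : ℕ} (i m : Fin (2 * g + 2)) :
    ((i + m : Fin (2 * g + 2)) : ℕ) % 2 = ((i : ℕ) + m) % 2 := by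
  rw [Fin.val_add, Nat.mod_mod_of_dvd _ (by omega)]

lemma rename_polyH {g : ℕ} {σ : Equiv.Perm (Fin (2 * g + 2))} (hσ : σ ∈ thetaGroup g) :
    rename σ (polyH g) = polyH g := by
  -- `m = 0` when `σ` preserves parities, `m = 1` when it exchanges them.
  have key : ∀ m : Fin (2 * g + 2), (∀ i, (σ i : ℕ) % 2 = ((i : ℕ) + m) % 2) →
      rename σ (polyH g) = polyH g := by
    intro m hm
    rw [polyH, map_mul, map_sum, algHom_C]
    congr 1
    refine Finset.sum_equiv ((Equiv.mulLeft σ).trans (Equiv.mulRight (Equiv.addRight m)))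
      (fun e => ?_) fun e _ => ?_
    · simp only [mem_alternating, Equiv.trans_apply, Equiv.coe_mulLeft, Equiv.coe_mulRight,
        Equiv.Perm.mul_apply, Equiv.coe_addRight, hm]
      constructor
      · intro h i
        have h1 := h (i + m)
        rw [val_add_mod_two] at h1
        omega
      · intro h i
        have h1 := h (i - m)
        rw [sub_add_cancel] at h1
        have h2 := val_add_mod_two (i - m) m
        rw [sub_add_cancel] at h2
        omega
    · rw [Equiv.trans_apply, Equiv.coe_mulLeft, Equiv.coe_mulRight,
        rename_mul_addRight_cycleCofactor, Equiv.Perm.coe_mul, rename_rename]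
  rcases parity_of_mem_thetaGroup hσ with h | h
  · exact key 0 (by simpa using h)
  · exact key 1 (by simpa using h)

/-! ### The sum over the symmetric group -/

/-- Summed over all arrangements of distinct numbers, the reciprocals of the cyclic products of
consecutive differences cancel. Write `x` for the first entry and `d` for the remaining ones: the
reciprocal is `1 / (c (x - d_0)) - 1 / (c (x - d_last))`, where `c` is the cyclic product of `d`, and
the two parts are interchanged by a rotation of `d`. -/
lemma sum_perm_inv_cyclic_prod {n : ℕ} (a : Fin (n + 3) → ℂ) (ha : Function.Injective a) :
    ∑ σ : Equiv.Perm (Fin (n + 3)),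
      (∏ i, (a (σ i) - a (σ (finRotate (n + 3) i))))⁻¹ = 0 := by
  let c : (Fin (n + 3) → ℂ) → ℂ := fun b =>
    ∏ i : Fin (n + 2), (b i.succ - b (finRotate (n + 2) i).succ)
  let G : (Fin (n + 3) → ℂ) → ℂ := fun b => (c b)⁻¹ * (b 0 - b 1)⁻¹
  let τ : Equiv.Perm (Fin (n + 3)) := Equiv.Perm.decomposeFin.symm (0, (finRotate (n + 2)).symm)
  have hτ0 : τ 0 = 0 := by simp [τ]
  have hτ : ∀ i : Fin (n + 2), τ i.succ = ((finRotate (n + 2)).symm i).succ := fun i => by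
    simp only [τ, Equiv.Perm.decomposeFin_symm_apply_succ, Equiv.swap_self, Equiv.refl_apply]
  -- `τ` fixes the first entry and moves the last one to the second place.
  have hlast : (finRotate (n + 2)).symm 0 = Fin.last (n + 1) := by
    rw [Equiv.symm_apply_eq, finRotate_last]
  have key : ∀ σ : Equiv.Perm (Fin (n + 3)),
      (∏ i, (a (σ i) - a (σ (finRotate (n + 3) i))))⁻¹ =
        G (a ∘ σ) - G (a ∘ (σ * τ : Equiv.Perm (Fin (n + 3)))) := by
    intro σ
    have hinj : Function.Injective (a ∘ σ) := ha.comp σ.injective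
    rw [Equiv.Perm.coe_mul, ← Function.comp_assoc]
    have h1 : (∏ i, (a (σ i) - a (σ (finRotate (n + 3) i)))) =
        ∏ i, ((a ∘ σ) i - (a ∘ σ) (finRotate (n + 3) i)) := rfl
    rw [h1]
    generalize a ∘ σ = b at hinj
    have hc : c (b ∘ τ) = c b := by
      simp only [c, Function.comp_apply, hτ]
      rw [← Equiv.prod_comp (finRotate (n + 2))]
      simp only [Equiv.symm_apply_apply]
    have hone : τ 1 = Fin.last (n + 2) := by
      rw [← Fin.succ_zero_eq_one, hτ, hlast, Fin.succ_last]
    simp only [G, hc, Function.comp_apply, hτ0, hone]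
    let R := ∏ i : Fin (n + 1), (b i.castSucc.succ - b i.succ.succ)
    have hcR : c b = R * (b (Fin.last (n + 2)) - b 1) := by
      simp only [c]
      rw [Fin.prod_univ_castSucc, finRotate_last, Fin.succ_last, Fin.succ_zero_eq_one]
      simp [R]
    have hψ : ∏ i, (b i - b (finRotate (n + 3) i)) =
        (b 0 - b 1) * R * (b (Fin.last (n + 2)) - b 0) := by
      have hrot : ∀ i : Fin (n + 2), finRotate (n + 3) i.castSucc = i.succ := fun i => by simp
      rw [Fin.prod_univ_castSucc, finRotate_last]
      simp only [hrot]
      rw [Fin.prod_univ_succ]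
      simp [R]
    have hR : R ≠ 0 := Finset.prod_ne_zero_iff.mpr fun i _ =>
      sub_ne_zero.mpr fun h => (Fin.castSucc_lt_succ (i := i)).ne (Fin.succ_injective _ (hinj h))
    have h01 : b 0 - b 1 ≠ 0 := sub_ne_zero.mpr fun h => by simpa using hinj h
    have hl0 : b (Fin.last (n + 2)) - b 0 ≠ 0 := sub_ne_zero.mpr fun h => by
      simpa [Fin.ext_iff] using hinj h
    have hl1 : b (Fin.last (n + 2)) - b 1 ≠ 0 := sub_ne_zero.mpr fun h => by
      simpa [Fin.ext_iff] using hinj h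
    have h0l : b 0 - b (Fin.last (n + 2)) ≠ 0 := by
      rw [← neg_sub]
      exact neg_ne_zero.mpr hl0
    rw [hψ, hcR]
    field_simp
    ring
  simp only [key, Finset.sum_sub_distrib]
  rw [sub_eq_zero]
  exact (Equiv.sum_comp (Equiv.mulRight τ) fun σ : Equiv.Perm (Fin (n + 3)) => G (a ∘ σ)).symm

lemma sum_perm_rename_cycleCofactor (n : ℕ) :
    ∑ σ : Equiv.Perm (Fin (n + 3)), rename σ (cycleCofactor (n + 3)) = 0 := by
  refine eq_zero_of_mul _ (diffProd (· ≠ ·))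
    (diffProd_ne_zero (r := n + 3) (· ≠ ·) fun i => by simp) fun x hx => ?_
  set a : Fin (n + 3) → ℂ := fun i => (x i : ℂ) with ha
  have hinj : Function.Injective a := by
    intro i j hij
    by_contra hne
    refine hx ?_
    simp only [diffProd, map_prod]
    refine Finset.prod_eq_zero (Finset.mem_univ i) (Finset.prod_eq_zero (Finset.mem_univ j) ?_)
    rw [if_pos hne, map_sub, eval_X, eval_X, hij, sub_self]
  have hterm : ∀ σ : Equiv.Perm (Fin (n + 3)), eval a (rename σ (cycleCofactor (n + 3))) =
      eval a (diffProd (· ≠ ·)) * (∏ i, (a (σ i) - a (σ (finRotate (n + 3) i))))⁻¹ := by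
    intro σ
    have h1 := congrArg (eval a) (psi_mul_cycleCofactor (n := n + 1) σ)
    rw [map_mul, psi_eq_prod, map_prod] at h1
    simp only [map_sub, eval_X] at h1
    rw [eq_mul_inv_iff_mul_eq₀, mul_comm]
    · exact h1
    · intro h0
      exact hx (h1.symm.trans (mul_eq_zero_of_left h0 _))
  rw [map_sum]
  simp only [hterm]
  rw [← Finset.mul_sum, sum_perm_inv_cyclic_prod a hinj, mul_zero]

lemma sum_perm_rename_polyH {g : ℕ} (hg : 1 ≤ g) :
    ∑ σ : Equiv.Perm (Fin (2 * g + 2)), rename σ (polyH g) = 0 := by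
  obtain ⟨k, rfl⟩ := Nat.exists_eq_add_of_le' hg
  simp only [polyH, map_mul, map_sum, algHom_C]
  rw [← Finset.mul_sum, Finset.sum_comm, Finset.sum_eq_zero, mul_zero]
  intro e _
  rw [← sum_perm_rename_cycleCofactor (2 * k + 1)]
  refine Fintype.sum_equiv (Equiv.mulRight e) _ _ fun σ => ?_
  rw [rename_rename]
  rfl

/-! ### The case of four variables -/

lemma aeval_cycleCofactor_four {A : Type*} [CommRing A] [Algebra ℂ A] (v : Fin 4 → A) :
    aeval v (cycleCofactor 4) = (v 0 - v 2) * (v 0 - v 3) * (v 1 - v 0) * (v 1 - v 3) *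
      (v 2 - v 0) * (v 2 - v 1) * (v 3 - v 1) * (v 3 - v 2) := by
  rw [cycleCofactor, aeval_diffProd]
  simp only [Fin.prod_univ_four, finRotate_apply]
  simp +decide
  ring

lemma alternating_four : alternating (2 * 1 + 2) =
    {1, Equiv.swap 0 2, Equiv.swap 1 3, Equiv.swap 0 2 * Equiv.swap 1 3} := by
  decide +kernel

lemma polyH_one : polyH 1 =
    disc (Finset.univ : Finset (Fin (2 * 1 + 2))) * disc (oddSet 1) * disc (oddSet 1)ᶜ := by
  have h1 : ((Finset.univ ×ˢ Finset.univ : Finset (Fin (2 * 1 + 2) × Fin (2 * 1 + 2))).filter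
      fun p => p.2 < p.1) = {(1, 0), (2, 0), (3, 0), (2, 1), (3, 1), (3, 2)} := by
    decide +kernel
  have h2 : ((oddSet 1 ×ˢ oddSet 1).filter fun p => p.2 < p.1) = {(2, 0)} := by
    decide +kernel
  have h3 : (((oddSet 1)ᶜ ×ˢ (oddSet 1)ᶜ).filter fun p => p.2 < p.1) = {(3, 1)} := by
    decide +kernel
  have hC : (C ((-1 / 2 : ℂ) ^ 1 / ((1 : ℕ) + 1)) : CPoly (2 * 1 + 2)) * 4 = -1 := by
    have h4 : (4 : CPoly (2 * 1 + 2)) = C 4 := (map_ofNat C 4).symm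
    rw [h4, ← C_mul]
    norm_num
  have hs : ∑ e ∈ alternating (2 * 1 + 2), rename e (cycleCofactor (2 * 1 + 2)) =
      -4 * (disc (Finset.univ : Finset (Fin (2 * 1 + 2))) * disc (oddSet 1) *
        disc (oddSet 1)ᶜ) := by
    rw [alternating_four, disc, disc, disc, h1, h2, h3]
    rw [Finset.sum_insert (by decide +kernel), Finset.sum_insert (by decide +kernel),
      Finset.sum_insert (by decide +kernel), Finset.sum_singleton]
    simp only [rename_eq_aeval]
    have h5 : ∀ v : Fin (2 * 1 + 2) → CPoly (2 * 1 + 2), aeval v (cycleCofactor (2 * 1 + 2)) = _ :=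
      aeval_cycleCofactor_four
    simp only [h5, Function.comp_apply]
    simp +decide [Equiv.swap_apply_def]
    ring
  rw [polyH, hs]
  linear_combination (-disc Finset.univ * disc (oddSet 1) * disc (oddSet 1)ᶜ) * hC

/-! ### Cyclic two-colourings -/

section Coloring

variable {r : ℕ} (c : Fin r → Prop) [DecidablePred c]

/-- `1` if `i` and `j` have different colours, `0` otherwise. -/
def crossing (i j : Fin r) : ℕ := if c i ↔ c j then 0 else 1

/-- The positions at which the colour changes from `c` to its negation along a permutation. -/
def descents (ρ : Equiv.Perm (Fin r)) : Finset (Fin r) :=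
  Finset.univ.filter fun i => c i ∧ ¬ c (ρ i)

lemma sum_sum_crossing {a b : ℕ} (hr : a + b = r) (hb : (Finset.univ.filter c).card = b) :
    ∑ i, ∑ j, crossing c i j = 2 * (a * b) := by
  have ha : (Finset.univ.filter fun i => ¬ c i).card = a := by
    have h := Finset.card_filter_add_card_filter_not (s := Finset.univ) c
    rw [hb, Finset.card_univ, Fintype.card_fin] at h
    omega
  have h1 : ∀ i j, crossing c i j =
      (if c i then 1 else 0) * (if ¬ c j then 1 else 0) +
      (if ¬ c i then 1 else 0) * (if c j then 1 else 0) := by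
    intro i j
    by_cases hi : c i <;> by_cases hj : c j <;> simp [crossing, hi, hj]
  simp only [h1, Finset.sum_add_distrib, ← Finset.mul_sum, ← Finset.sum_mul]
  rw [← Finset.card_filter, ← Finset.card_filter, ha, hb]
  ring

/-- Along a permutation the colour changes equally often in both directions. -/
lemma sum_crossing_perm (ρ : Equiv.Perm (Fin r)) :
    ∑ i, crossing c i (ρ i) = 2 * (descents c ρ).card := by
  have h1 : ∀ i, crossing c i (ρ i) + (if c i then 1 else 0) =
      2 * (if c i ∧ ¬ c (ρ i) then 1 else 0) + (if c (ρ i) then 1 else 0) := by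
    intro i
    by_cases hi : c i <;> by_cases hj : c (ρ i) <;> simp [crossing, hi, hj]
  have h2 := Finset.sum_congr (rfl : (Finset.univ : Finset (Fin r)) = Finset.univ)
    fun i _ => h1 i
  rw [Finset.sum_add_distrib, Finset.sum_add_distrib, ← Finset.mul_sum,
    Equiv.sum_comp ρ fun i => if c i then 1 else 0, ← Finset.card_filter] at h2
  rw [descents, Finset.card_filter]
  exact Nat.add_right_cancel h2

/-- The number of pairs in the cofactor of a Hamiltonian cycle whose colours differ. -/
lemma sum_cofactor_crossing (ρ : Equiv.Perm (Fin r)) {a b : ℕ} (hr : a + b = r)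
    (hb : (Finset.univ.filter c).card = b) :
    (∑ i, ∑ j, if i ≠ j ∧ j ≠ ρ i then crossing c i j else 0) + 2 * (descents c ρ).card =
      2 * (a * b) := by
  rw [← sum_crossing_perm, ← sum_sum_crossing c hr hb, ← Finset.sum_add_distrib]
  refine Finset.sum_congr rfl fun i _ => ?_
  have h1 : crossing c i (ρ i) = ∑ j, if j = ρ i then crossing c i j else 0 := by
    rw [Finset.sum_ite_eq' Finset.univ (ρ i), if_pos (Finset.mem_univ _)]
  rw [h1, ← Finset.sum_add_distrib]
  refine Finset.sum_congr rfl fun j _ => ?_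
  by_cases hj : j = ρ i
  · simp [hj]
  · by_cases hij : i = j
    · simp [hij, crossing]
    · simp [hj, hij]

end Coloring

/-- A colouring of a cycle with both colours has a descent. -/
lemma exists_descent {n : ℕ} (c : Fin (n + 1) → Prop) (h1 : ∃ i, c i) (h0 : ∃ i, ¬ c i) :
    ∃ i, c i ∧ ¬ c (i + 1) := by
  by_contra! h
  obtain ⟨i, hi⟩ := h1
  obtain ⟨j, hj⟩ := h0
  have hlast : c (Fin.last n) := by
    revert hi
    refine Fin.reverseInduction (motive := fun i => c i → c (Fin.last n)) id
      (fun k ih hk => ih ?_) i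
    rw [← Fin.coeSucc_eq_succ]
    exact h _ hk
  have hzero : c 0 := by
    rw [← Fin.last_add_one]
    exact h _ hlast
  refine hj (Fin.induction (motive := c) hzero (fun k hk => ?_) j)
  rw [← Fin.coeSucc_eq_succ]
  exact h _ hk

/-- A colouring of `0, …, n` that can descend only from `n` to `0` colours a final segment. -/
lemma coloring_eq_final_segment {n a b : ℕ} (hn : a + b = n + 1) (c : Fin (n + 1) → Prop)
    [DecidablePred c] (hb : (Finset.univ.filter c).card = b)
    (h : ∀ i, i ≠ Fin.last n → c i → c (i + 1)) (i : Fin (n + 1)) : c i ↔ a ≤ (i : ℕ) := by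
  have hmono : ∀ i j : Fin (n + 1), i ≤ j → c i → c j := by
    intro i j
    refine Fin.induction (motive := fun j => i ≤ j → c i → c j) ?_ (fun k ih hk hi => ?_) j
    · intro h0 hi
      rwa [← Fin.le_zero_iff.mp h0]
    · rcases hk.eq_or_lt with rfl | hlt
      · exact hi
      · rw [← Fin.coeSucc_eq_succ]
        exact h _ (Fin.castSucc_lt_last k).ne (ih (Fin.le_castSucc_iff.mpr hlt) hi)
  constructor
  · intro hi
    have h1 : Finset.Ici i ⊆ Finset.univ.filter c := fun j hj =>
      Finset.mem_filter.mpr ⟨Finset.mem_univ j, hmono i j (Finset.mem_Ici.mp hj) hi⟩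
    have h2 := Finset.card_le_card h1
    rw [Fin.card_Ici, hb] at h2
    omega
  · intro hi
    by_contra hc
    have h1 : Finset.univ.filter c ⊆ Finset.Ioi i := fun j hj => by
      rw [Finset.mem_Ioi]
      by_contra hle
      exact hc (hmono j i (not_lt.mp hle) (Finset.mem_filter.mp hj).2)
    have h2 := Finset.card_le_card h1
    rw [Fin.card_Ioi, hb] at h2
    omega

/-! ### Rotating an arrangement so that it splits -/

/-- An arrangement of `1, …, r` whose first `a` entries are `1, …, a` in some order. -/
def IsSplit {r : ℕ} (a : ℕ) (e : Equiv.Perm (Fin r)) : Prop :=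
  ∀ i, a ≤ (e i : ℕ) ↔ a ≤ (i : ℕ)

instance {r a : ℕ} : DecidablePred (IsSplit (r := r) a) := fun e => by
  unfold IsSplit
  infer_instance

lemma card_filter_le_val {a b r : ℕ} (hr : a + b = r) (e : Equiv.Perm (Fin r)) :
    (Finset.univ.filter fun i => a ≤ (e i : ℕ)).card = b := by
  rw [Finset.card_filter, Equiv.sum_comp e fun i : Fin r => if a ≤ (i : ℕ) then 1 else 0,
    ← Finset.card_filter]
  rcases Nat.eq_zero_or_pos b with rfl | hb
  · rw [Finset.card_eq_zero, Finset.filter_eq_empty_iff]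
    intro i _
    omega
  · have h : (Finset.univ.filter fun i : Fin r => a ≤ (i : ℕ)) = Finset.Ici ⟨a, by omega⟩ := by
      ext i
      simp [Fin.le_def]
    rw [h, Fin.card_Ici]
    simp only
    omega

/-- A split rotation starts right after a descent, so distinct split rotations give distinct
descents. -/
lemma mem_descents_of_isSplit_rotate {n a b : ℕ} (hn : a + b = n + 1) (ha : 1 ≤ a) (hb : 1 ≤ b)
    {e : Equiv.Perm (Fin (n + 1))} {m : Fin (n + 1)} (h : IsSplit a (e * Equiv.addRight m)) :
    Fin.last n + m ∈ descents (fun i => a ≤ (e i : ℕ)) (finRotate (n + 1)) := by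
  simp only [descents, Finset.mem_filter, Finset.mem_univ, true_and]
  have h1 := h (Fin.last n)
  have h2 := h 0
  simp only [Equiv.Perm.mul_apply, Equiv.coe_addRight, Fin.val_last, Fin.val_zero] at h1 h2
  rw [finRotate_apply, add_right_comm, Fin.last_add_one]
  omega

/-- If there is a single descent, the rotation starting right after it is split. -/
lemma isSplit_rotate_of_descents {n a b : ℕ} (hn : a + b = n + 1) {e : Equiv.Perm (Fin (n + 1))}
    {i : Fin (n + 1)}
    (h : descents (fun i => a ≤ (e i : ℕ)) (finRotate (n + 1)) = {i}) :
    IsSplit a (e * Equiv.addRight (i + 1)) := by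
  refine coloring_eq_final_segment hn _ (card_filter_le_val hn _) fun j hj hc => ?_
  by_contra hc'
  have h1 : j + (i + 1) ∈ descents (fun i => a ≤ (e i : ℕ)) (finRotate (n + 1)) := by
    simp only [descents, Finset.mem_filter, Finset.mem_univ, true_and, finRotate_apply]
    refine ⟨hc, ?_⟩
    rw [add_right_comm]
    exact hc'
  rw [h, Finset.mem_singleton] at h1
  refine hj ?_
  have h2 : j + 1 = 0 := by
    refine add_right_cancel (b := i) ?_
    rw [zero_add, add_assoc, add_comm 1 i]
    exact h1
  rw [← Fin.last_add_one n] at h2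
  exact add_right_cancel h2

/-- Among the first `2a + 1` labels the odd ones outnumber the even ones, so an alternating
arrangement can be brought into split position only by an even rotation. -/
lemma even_of_isSplit_rotate {g a : ℕ} (ha : a ≤ g) {e : Equiv.Perm (Fin (2 * g + 2))}
    (he : e ∈ alternating (2 * g + 2)) {m : Fin (2 * g + 2)}
    (h : IsSplit (2 * a + 1) (e * Equiv.addRight m)) : (m : ℕ) % 2 = 0 := by
  by_contra hm
  rw [mem_alternating] at he
  have hval : ∀ i : Fin (a + 1), (e (⟨2 * i, by omega⟩ + m) : ℕ) < 2 * a + 1 ∧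
      (e (⟨2 * i, by omega⟩ + m) : ℕ) % 2 = 1 := by
    intro i
    have h1 := h ⟨2 * i, by omega⟩
    have h2 := he (⟨2 * i, by omega⟩ + m)
    rw [val_add_mod_two] at h2
    simp only [Equiv.Perm.mul_apply, Equiv.coe_addRight] at h1 h2
    omega
  -- An odd rotation would send the `a + 1` even positions `2 i ≤ 2 a` injectively to the `a` odd
  -- values below `2 a + 1`.
  have hinj : Function.Injective fun i : Fin (a + 1) =>
      (⟨(e (⟨2 * i, by omega⟩ + m) : ℕ) / 2, by have := hval i; omega⟩ : Fin a) := by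
    intro i j hij
    have hi := hval i
    have hj := hval j
    have h1 := Fin.mk.inj_iff.mp hij
    have h2 : e (⟨2 * i, by omega⟩ + m) = e (⟨2 * j, by omega⟩ + m) := by
      rw [Fin.ext_iff]
      omega
    have h3 := Fin.mk.inj_iff.mp (add_right_cancel (e.injective h2))
    rw [Fin.ext_iff]
    omega
  have := Fintype.card_le_of_injective _ hinj
  simp at this

lemma card_even (g : ℕ) :
    (Finset.univ.filter fun m : Fin (2 * g + 2) => (m : ℕ) % 2 = 0).card = g + 1 := by
  rw [← Fintype.card_fin (g + 1), ← Finset.card_univ]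
  symm
  refine Finset.card_nbij' (fun i => ⟨2 * i, by omega⟩) (fun m => ⟨m / 2, by omega⟩) ?_ ?_ ?_ ?_
  · intro i _
    simp
  · intro m _
    simp
  · intro i _
    simp
  · intro m hm
    have h := (Finset.mem_filter.mp hm).2
    rw [Fin.ext_iff]
    simp only
    omega

/-- If `F` is invariant under rotations and supported on arrangements with a single descent, each
arrangement in the support has exactly one of its `g + 1` even rotations in split position. -/
lemma sum_alternating_eq_sum_split {A : Type*} [CommRing A] {g a b : ℕ} (hg : a + b = g)
    (F : Equiv.Perm (Fin (2 * g + 2)) → A) (hF : ∀ e m, F (e * Equiv.addRight m) = F e)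
    (hsupp : ∀ e, F e ≠ 0 → ∃ i,
      descents (fun i => 2 * a + 1 ≤ (e i : ℕ)) (finRotate (2 * g + 2)) = {i}) :
    ∑ e ∈ alternating (2 * g + 2), F e =
      (g + 1) * ∑ e ∈ (alternating (2 * g + 2)).filter (IsSplit (2 * a + 1)), F e := by
  set E := Finset.univ.filter fun m : Fin (2 * g + 2) => (m : ℕ) % 2 = 0 with hE
  have hn : (2 * a + 1) + (2 * b + 1) = (2 * g + 1) + 1 := by omega
  have h1 : ∀ e ∈ alternating (2 * g + 2), F e =
      ∑ m ∈ E, if IsSplit (2 * a + 1) (e * Equiv.addRight m) then F (e * Equiv.addRight m)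
        else 0 := by
    intro e he
    simp only [hF]
    by_cases h0 : F e = 0
    · simp [h0]
    obtain ⟨i, hi⟩ := hsupp e h0
    have hs := isSplit_rotate_of_descents hn hi
    rw [Finset.sum_eq_single_of_mem (i + 1)
      (Finset.mem_filter.mpr ⟨Finset.mem_univ _, even_of_isSplit_rotate (by omega) he hs⟩),
      if_pos hs]
    intro m _ hm
    rw [if_neg]
    intro hs'
    have h2 := mem_descents_of_isSplit_rotate hn (by omega) (by omega) hs
    have h3 := mem_descents_of_isSplit_rotate hn (by omega) (by omega) hs'
    rw [hi, Finset.mem_singleton] at h2 h3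
    exact hm (add_left_cancel (h3.trans h2.symm))
  rw [Finset.sum_congr rfl h1, Finset.sum_comm]
  have h4 : ∀ m ∈ E, (∑ e ∈ alternating (2 * g + 2),
      if IsSplit (2 * a + 1) (e * Equiv.addRight m) then F (e * Equiv.addRight m) else 0) =
      ∑ e ∈ (alternating (2 * g + 2)).filter (IsSplit (2 * a + 1)), F e := by
    intro m hm
    have hm' := (Finset.mem_filter.mp hm).2
    rw [Finset.sum_filter]
    refine Finset.sum_equiv (Equiv.mulRight (Equiv.addRight m)) (fun e => ?_) fun e _ => rfl
    simp only [mem_alternating, Equiv.coe_mulRight, Equiv.Perm.mul_apply, Equiv.coe_addRight]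
    constructor
    · intro h i
      have h5 := h (i + m)
      rw [val_add_mod_two] at h5
      omega
    · intro h i
      have h5 := h (i - m)
      have h6 := val_add_mod_two (i - m) m
      rw [sub_add_cancel] at h5 h6
      omega
  rw [Finset.sum_congr rfl h4, Finset.sum_const, card_even, nsmul_eq_mul]
  push_cast
  ring

/-! ### Pulling two groups of points apart -/

lemma natDegree_prod_le_and_coeff {S ι : Type*} [CommRing S] (s : Finset ι)
    (f : ι → Polynomial S) (n : ι → ℕ) (h : ∀ i, (f i).natDegree ≤ n i) :
    (∏ i ∈ s, f i).natDegree ≤ ∑ i ∈ s, n i ∧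
      (∏ i ∈ s, f i).coeff (∑ i ∈ s, n i) = ∏ i ∈ s, (f i).coeff (n i) := by
  classical
  induction s using Finset.induction_on with
  | empty => simp
  | insert i s hi ih =>
    rw [Finset.prod_insert hi, Finset.sum_insert hi, Finset.prod_insert hi]
    exact ⟨Polynomial.natDegree_mul_le_of_le (h i) ih.1,
      by rw [Polynomial.coeff_mul_add_eq_of_natDegree_le (h i) ih.1, ih.2]⟩

variable {S : Type*} [CommRing S]

section Colored

variable {r : ℕ} (c : Fin r → Prop) [DecidablePred c] (v : Fin r → S)

/-- The values `v_i`, with the indeterminate `t` added where `c` holds. -/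
def shifted (i : Fin r) : Polynomial S := Polynomial.C (v i) + if c i then Polynomial.X else 0

/-- The coefficient of `t ^ crossing c i j` in the difference of two shifted values. -/
def topCoeff (i j : Fin r) : S :=
  if c i ↔ c j then v i - v j else if c i then 1 else -1

lemma natDegree_shifted_sub_and_coeff (i j : Fin r) :
    (shifted c v i - shifted c v j).natDegree ≤ crossing c i j ∧
      (shifted c v i - shifted c v j).coeff (crossing c i j) = topCoeff c v i j := by
  have hsub : shifted c v i - shifted c v j = Polynomial.C (v i - v j) +
      ((if c i then Polynomial.X else 0) - if c j then Polynomial.X else 0) := by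
    rw [shifted, shifted, Polynomial.C_sub]
    ring
  rw [hsub]
  by_cases hi : c i <;> by_cases hj : c j <;>
    simp only [hi, hj, crossing, topCoeff, if_true, if_false, sub_self, sub_zero, zero_sub,
      add_zero, iff_true, iff_false, not_true_eq_false]
  · exact ⟨(Polynomial.natDegree_C _).le, Polynomial.coeff_C_zero⟩
  · exact ⟨Polynomial.natDegree_C_add.trans_le Polynomial.natDegree_X_le, by simp⟩
  · refine ⟨Polynomial.natDegree_C_add.trans_le ?_, by simp⟩
    rw [Polynomial.natDegree_neg]
    exact Polynomial.natDegree_X_le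
  · exact ⟨(Polynomial.natDegree_C _).le, Polynomial.coeff_C_zero⟩

/-- Degree bound and extremal coefficient for the cofactor of a Hamiltonian cycle at shifted
values. -/
lemma natDegree_cofactor_and_coeff (ρ : Equiv.Perm (Fin r)) :
    (∏ i, ∏ j, if i ≠ j ∧ j ≠ ρ i then shifted c v i - shifted c v j else 1).natDegree ≤
      (∑ i, ∑ j, if i ≠ j ∧ j ≠ ρ i then crossing c i j else 0) ∧
    (∏ i, ∏ j, if i ≠ j ∧ j ≠ ρ i then shifted c v i - shifted c v j else 1).coeff
      (∑ i, ∑ j, if i ≠ j ∧ j ≠ ρ i then crossing c i j else 0) =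
      ∏ i, ∏ j, if i ≠ j ∧ j ≠ ρ i then topCoeff c v i j else 1 := by
  have h0 : ∀ i j, (if i ≠ j ∧ j ≠ ρ i then shifted c v i - shifted c v j else 1).natDegree ≤
      (if i ≠ j ∧ j ≠ ρ i then crossing c i j else 0) := by
    intro i j
    by_cases h : i ≠ j ∧ j ≠ ρ i
    · rw [if_pos h, if_pos h]
      exact (natDegree_shifted_sub_and_coeff c v i j).1
    · rw [if_neg h, if_neg h, Polynomial.natDegree_one]
  have h1 := fun i => natDegree_prod_le_and_coeff Finset.univ _ _ (h0 i)
  have h2 := natDegree_prod_le_and_coeff Finset.univ _ _ (fun i => (h1 i).1)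
  refine ⟨h2.1, h2.2.trans (Finset.prod_congr rfl fun i _ => (h1 i).2.trans
    (Finset.prod_congr rfl fun j _ => ?_))⟩
  by_cases h : i ≠ j ∧ j ≠ ρ i
  · rw [if_pos h, if_pos h, if_pos h]
    exact (natDegree_shifted_sub_and_coeff c v i j).2
  · rw [if_neg h, if_neg h, if_neg h, Polynomial.coeff_one_zero]

end Colored

lemma prod_prod_neg_one_of_ne {a b : ℕ} (ha : Odd a) (hb : Odd b) (i₀ : Fin a) (j₀ : Fin b) :
    (∏ i, ∏ j, if ¬ (i = i₀ ∧ j = j₀) then (-1 : S) else 1) = 1 := by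
  have h1 : ∀ i j, (if ¬ (i = i₀ ∧ j = j₀) then (-1 : S) else 1) =
      (-1) * if i = i₀ then (if j = j₀ then -1 else 1) else 1 := by
    intro i j
    by_cases hi : i = i₀ <;> by_cases hj : j = j₀ <;> simp [hi, hj]
  have h2 : ∀ i, (∏ j, if i = i₀ then (if j = j₀ then (-1 : S) else 1) else 1) =
      if i = i₀ then -1 else 1 := by
    intro i
    by_cases hi : i = i₀ <;> simp [hi]
  simp only [h1, Finset.prod_mul_distrib, h2]
  simp [ha.neg_one_pow, hb.neg_one_pow]

variable [Algebra ℂ S]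

/-- The substitution sending `a_i` to `u_i` for `i ≤ a` and to `u_i + t` for `i > a`. Both the
substitution in the Witt map and, with a single moving variable, the star map are of this form. -/
def pullFrom {r : ℕ} (a : ℕ) (u : Fin r → S) : CPoly r →ₐ[ℂ] Polynomial S :=
  aeval fun i => Polynomial.C (u i) + if a ≤ (i : ℕ) then Polynomial.X else 0

lemma pullFrom_rename_cycleCofactor {r : ℕ} (a : ℕ) (u : Fin r → S) (e : Equiv.Perm (Fin r)) :
    pullFrom a u (rename e (cycleCofactor r)) =
      ∏ i, ∏ j, if i ≠ j ∧ j ≠ finRotate r i then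
        shifted (fun i => a ≤ (e i : ℕ)) (fun i => u (e i)) i -
        shifted (fun i => a ≤ (e i : ℕ)) (fun i => u (e i)) j else 1 := by
  rw [pullFrom, aeval_rename, cycleCofactor, aeval_diffProd]
  rfl

lemma one_le_card_descents {n a b : ℕ} (hn : a + b = n + 1) (ha : 1 ≤ a) (hb : 1 ≤ b)
    (e : Equiv.Perm (Fin (n + 1))) :
    1 ≤ (descents (fun i => a ≤ (e i : ℕ)) (finRotate (n + 1))).card := by
  obtain ⟨i, hi⟩ := exists_descent (fun i => a ≤ (e i : ℕ))
    ⟨e.symm (Fin.last n), by simp; omega⟩ ⟨e.symm 0, by simp; omega⟩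
  refine Finset.card_pos.mpr ⟨i, ?_⟩
  simpa [descents] using hi

/-- Every Hamiltonian cycle runs at least twice between the two groups of points, which lowers the
degree of the cofactor by two. -/
lemma natDegree_pullFrom_le {n a b : ℕ} (hn : a + b = n + 1) (ha : 1 ≤ a) (hb : 1 ≤ b)
    (u : Fin (n + 1) → S) (e : Equiv.Perm (Fin (n + 1))) :
    (pullFrom a u (rename e (cycleCofactor (n + 1)))).natDegree ≤ 2 * (a * b) - 2 := by
  rw [pullFrom_rename_cycleCofactor]
  have h1 := (natDegree_cofactor_and_coeff (fun i => a ≤ (e i : ℕ)) (fun i => u (e i))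
    (finRotate (n + 1))).1
  have h2 := sum_cofactor_crossing (fun i => a ≤ (e i : ℕ)) (finRotate (n + 1)) hn
    (card_filter_le_val hn e)
  have h3 := one_le_card_descents hn ha hb e
  refine h1.trans ?_
  omega

/-- The extremal coefficient vanishes unless the cycle runs exactly twice between the two groups. -/
lemma descents_of_coeff_ne_zero {n a b : ℕ} (hn : a + b = n + 1) (ha : 1 ≤ a) (hb : 1 ≤ b)
    (u : Fin (n + 1) → S) (e : Equiv.Perm (Fin (n + 1)))
    (h : (pullFrom a u (rename e (cycleCofactor (n + 1)))).coeff (2 * (a * b) - 2) ≠ 0) :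
    ∃ i, descents (fun i => a ≤ (e i : ℕ)) (finRotate (n + 1)) = {i} := by
  rw [pullFrom_rename_cycleCofactor] at h
  have h1 := (natDegree_cofactor_and_coeff (fun i => a ≤ (e i : ℕ)) (fun i => u (e i))
    (finRotate (n + 1))).1
  have h2 := sum_cofactor_crossing (fun i => a ≤ (e i : ℕ)) (finRotate (n + 1)) hn
    (card_filter_le_val hn e)
  have h3 := one_le_card_descents hn ha hb e
  have h4 := (Polynomial.le_natDegree_of_ne_zero h).trans h1
  rw [← Finset.card_eq_one]
  omega

lemma descents_final_segment {a b : ℕ} (ha : 1 ≤ a) (hb : 1 ≤ b) :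
    descents (fun i : Fin (a + b) => a ≤ (i : ℕ)) (finRotate (a + b)) =
      {⟨a + b - 1, by omega⟩} := by
  ext i
  have hi := i.2
  simp only [descents, Finset.mem_filter, Finset.mem_univ, true_and, Finset.mem_singleton,
    Fin.ext_iff, coe_finRotate]
  rcases lt_or_ge ((i : ℕ) + 1) (a + b) with h | h
  · rw [Nat.mod_eq_of_lt h]
    omega
  · rw [show (i : ℕ) + 1 = a + b by omega, Nat.mod_self]
    omega

/-- For an arrangement in split position the extremal coefficient factors into the cofactors of
the two Hamiltonian paths left after removing the two edges joining the groups. -/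
lemma coeff_pullFrom_of_isSplit {a b : ℕ} (ha : Odd a) (hb : Odd b) (u : Fin (a + b) → S)
    {e : Equiv.Perm (Fin (a + b))} (he : IsSplit a e) :
    (pullFrom a u (rename e (cycleCofactor (a + b)))).coeff (2 * (a * b) - 2) =
      aeval (fun k => u (e (Fin.castAdd b k))) (pathCofactor a) *
      aeval (fun k => u (e (Fin.natAdd a k))) (pathCofactor b) := by
  have ha1 : 1 ≤ a := ha.pos
  have hb1 : 1 ≤ b := hb.pos
  have hcol : (fun i => a ≤ (e i : ℕ)) = fun i : Fin (a + b) => a ≤ (i : ℕ) :=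
    funext fun i => propext (he i)
  obtain ⟨v, hv⟩ : ∃ v : Fin (a + b) → S, v = fun i => u (e i) := ⟨_, rfl⟩
  have hv' : ∀ i, u (e i) = v i := fun i => by rw [hv]
  have hdeg := sum_cofactor_crossing (fun i : Fin (a + b) => a ≤ (i : ℕ)) (finRotate (a + b)) rfl
    (card_filter_le_val rfl (Equiv.refl _))
  rw [descents_final_segment ha1 hb1, Finset.card_singleton] at hdeg
  have hpull : pullFrom a u (rename e (cycleCofactor (a + b))) =
      ∏ i, ∏ j, if i ≠ j ∧ j ≠ finRotate (a + b) i then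
        shifted (fun i : Fin (a + b) => a ≤ (i : ℕ)) v i -
        shifted (fun i : Fin (a + b) => a ≤ (i : ℕ)) v j else 1 := by
    rw [pullFrom_rename_cycleCofactor, hv]
    congr! 6
  have hc := (natDegree_cofactor_and_coeff (fun i : Fin (a + b) => a ≤ (i : ℕ)) v
    (finRotate (a + b))).2
  rw [hpull, show 2 * (a * b) - 2 = _ from (Nat.eq_sub_of_add_eq hdeg).symm, hc]
  simp only [hv', pathCofactor, aeval_diffProd]
  -- Inside each group, the successor along the cycle is the successor along the path.
  have hrot1 : ∀ k : Fin a, (finRotate (a + b) (Fin.castAdd b k) : ℕ) = k + 1 := fun k => by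
    rw [coe_finRotate, Fin.val_castAdd, Nat.mod_eq_of_lt (by omega)]
  have hrot2 : ∀ k : Fin b, (finRotate (a + b) (Fin.natAdd a k) : ℕ) =
      if (k : ℕ) + 1 = b then 0 else a + k + 1 := fun k => by
    rw [coe_finRotate, Fin.val_natAdd]
    split_ifs with h
    · rw [add_assoc, h, Nat.mod_self]
    · rw [Nat.mod_eq_of_lt (by omega)]
  rw [Fin.prod_univ_add]
  simp only [Fin.prod_univ_add, Finset.prod_mul_distrib]
  have h11 : ∀ i j : Fin a, (if Fin.castAdd b i ≠ Fin.castAdd b j ∧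
      Fin.castAdd b j ≠ finRotate (a + b) (Fin.castAdd b i) then
      topCoeff (fun i : Fin (a + b) => a ≤ (i : ℕ)) v (Fin.castAdd b i) (Fin.castAdd b j) else 1) =
      if i ≠ j ∧ (j : ℕ) ≠ i + 1 then v (Fin.castAdd b i) - v (Fin.castAdd b j) else 1 := by
    intro i j
    refine if_congr ?_ ?_ rfl
    · rw [Ne, Ne, Fin.ext_iff, Fin.ext_iff, hrot1, Ne, Fin.ext_iff]
      rfl
    · simp [topCoeff, i.2.not_ge, j.2.not_ge]
  -- Each of the `a b - 1` remaining pairs from the first to the second group contributes `-1`; the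
  -- missing pair is the edge of the cycle joining the groups. Their number is even.
  have h12 : ∀ (i : Fin a) (j : Fin b), (if Fin.castAdd b i ≠ Fin.natAdd a j ∧
      Fin.natAdd a j ≠ finRotate (a + b) (Fin.castAdd b i) then
      topCoeff (fun i : Fin (a + b) => a ≤ (i : ℕ)) v (Fin.castAdd b i) (Fin.natAdd a j) else 1) =
      if ¬ (i = ⟨a - 1, by omega⟩ ∧ j = ⟨0, by omega⟩) then -1 else 1 := by
    intro i j
    refine if_congr ?_ ?_ rfl
    · rw [Ne, Ne, Fin.ext_iff, Fin.ext_iff, hrot1, Fin.ext_iff, Fin.ext_iff]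
      simp only [Fin.val_castAdd, Fin.val_natAdd]
      omega
    · simp [topCoeff, i.2.not_ge]
  have h21 : ∀ (i : Fin b) (j : Fin a), (if Fin.natAdd a i ≠ Fin.castAdd b j ∧
      Fin.castAdd b j ≠ finRotate (a + b) (Fin.natAdd a i) then
      topCoeff (fun i : Fin (a + b) => a ≤ (i : ℕ)) v (Fin.natAdd a i) (Fin.castAdd b j) else 1) =
      1 := by
    intro i j
    simp [topCoeff, j.2.not_ge]
  have h22 : ∀ i j : Fin b, (if Fin.natAdd a i ≠ Fin.natAdd a j ∧
      Fin.natAdd a j ≠ finRotate (a + b) (Fin.natAdd a i) then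
      topCoeff (fun i : Fin (a + b) => a ≤ (i : ℕ)) v (Fin.natAdd a i) (Fin.natAdd a j) else 1) =
      if i ≠ j ∧ (j : ℕ) ≠ i + 1 then v (Fin.natAdd a i) - v (Fin.natAdd a j) else 1 := by
    intro i j
    refine if_congr ?_ ?_ rfl
    · rw [Ne, Ne, Fin.ext_iff, Fin.ext_iff, hrot2, Ne, Fin.ext_iff]
      simp only [Fin.val_natAdd]
      split_ifs <;> omega
    · simp [topCoeff]
  simp only [h11, h12, h21, h22, Finset.prod_const_one, one_mul]
  rw [prod_prod_neg_one_of_ne ha hb, mul_one]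

/-- Arrangements in split position are pairs of arrangements of the two groups. -/
lemma sum_filter_isSplit {A : Type*} [AddCommMonoid A] {a b : ℕ}
    (F : Equiv.Perm (Fin (a + b)) → A) :
    ∑ e ∈ (alternating (a + b)).filter (IsSplit a), F e =
      ∑ e₁ ∈ alternating a, ∑ e₂ ∈ alternating b,
        F (finSumFinEquiv.permCongr (Equiv.Perm.sumCongr e₁ e₂)) := by
  have hleft : ∀ (p : Equiv.Perm (Fin a)) (q : Equiv.Perm (Fin b)) (k : Fin a),
      finSumFinEquiv.permCongr (Equiv.Perm.sumCongr p q) (Fin.castAdd b k) =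
        Fin.castAdd b (p k) := fun p q k => by simp [Equiv.permCongr_apply]
  have hright : ∀ (p : Equiv.Perm (Fin a)) (q : Equiv.Perm (Fin b)) (k : Fin b),
      finSumFinEquiv.permCongr (Equiv.Perm.sumCongr p q) (Fin.natAdd a k) =
        Fin.natAdd a (q k) := fun p q k => by simp [Equiv.permCongr_apply]
  have halt : ∀ (p : Equiv.Perm (Fin a)) (q : Equiv.Perm (Fin b)),
      finSumFinEquiv.permCongr (Equiv.Perm.sumCongr p q) ∈ alternating (a + b) ↔
        p ∈ alternating a ∧ q ∈ alternating b := by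
    intro p q
    simp only [mem_alternating, Fin.forall_fin_add, hleft, hright, Fin.val_castAdd,
      Fin.val_natAdd]
    exact and_congr Iff.rfl (forall_congr' fun k => by omega)
  rw [← Finset.sum_product']
  symm
  refine Finset.sum_nbij (fun p => finSumFinEquiv.permCongr (Equiv.Perm.sumCongr p.1 p.2))
    ?_ ?_ ?_ (fun _ _ => rfl)
  · intro p hp
    refine Finset.mem_filter.mpr ⟨(halt p.1 p.2).mpr (Finset.mem_product.mp hp), fun i => ?_⟩
    refine Fin.addCases (fun k => ?_) (fun k => ?_) i
    · simp only [hleft, Fin.val_castAdd]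
      omega
    · simp only [hright, Fin.val_natAdd]
      omega
  · intro p _ q _ hpq
    exact Equiv.Perm.sumCongrHom_injective (finSumFinEquiv.permCongr.injective hpq)
  · intro e he
    obtain ⟨he1, he2⟩ := Finset.mem_filter.mp he
    have hmaps : Set.MapsTo (finSumFinEquiv.symm.permCongr e)
        (Set.range (Sum.inl : Fin a → Fin a ⊕ Fin b)) (Set.range Sum.inl) := by
      rintro _ ⟨k, rfl⟩
      have hk : (e (Fin.castAdd b k) : ℕ) < a := by
        have h1 := he2 (Fin.castAdd b k)
        rw [Fin.val_castAdd] at h1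
        omega
      refine ⟨⟨_, hk⟩, finSumFinEquiv.injective ?_⟩
      simp [Equiv.permCongr_apply]
    obtain ⟨p, hp⟩ := Equiv.Perm.mem_sumCongrHom_range_of_perm_mapsTo_inl hmaps
    have hpe : finSumFinEquiv.permCongr (Equiv.Perm.sumCongr p.1 p.2) = e := by
      have h1 : Equiv.Perm.sumCongr p.1 p.2 = finSumFinEquiv.symm.permCongr e := hp
      rw [h1]
      ext i
      simp [Equiv.permCongr_apply]
    refine ⟨p, Finset.mem_coe.mpr (Finset.mem_product.mpr ((halt p.1 p.2).mp ?_)), hpe⟩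
    rwa [hpe]

/-! ### The degeneration of `H_g` -/

/-- The sum of the cofactors of all alternating Hamiltonian paths; up to the factor `(-1/2) ^ g` it
is the image of `H_g` under the star map when `r = 2g + 1`. -/
def pathSum (r : ℕ) : CPoly r := ∑ e ∈ alternating r, rename e (pathCofactor r)

lemma aeval_pathSum {r : ℕ} (v : Fin r → S) :
    aeval v (pathSum r) = ∑ e ∈ alternating r, aeval (fun k => v (e k)) (pathCofactor r) := by
  rw [pathSum, map_sum]
  exact Finset.sum_congr rfl fun e _ => aeval_rename _ _ _

lemma sum_split_coeff_pullFrom {r a b : ℕ} (hr : a + b = r) (ha : Odd a) (hb : Odd b)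
    (u : Fin r → S) :
    ∑ e ∈ (alternating r).filter (IsSplit a),
        (pullFrom a u (rename e (cycleCofactor r))).coeff (2 * (a * b) - 2) =
      aeval (fun k => u (Fin.cast hr (Fin.castAdd b k))) (pathSum a) *
        aeval (fun k => u (Fin.cast hr (Fin.natAdd a k))) (pathSum b) := by
  subst hr
  rw [Finset.sum_congr rfl fun e he =>
    coeff_pullFrom_of_isSplit ha hb u (Finset.mem_filter.mp he).2,
    sum_filter_isSplit fun e => aeval (fun k => u (e (Fin.castAdd b k))) (pathCofactor a) *
      aeval (fun k => u (e (Fin.natAdd a k))) (pathCofactor b),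
    aeval_pathSum, aeval_pathSum, Finset.sum_mul_sum]
  simp [Equiv.permCongr_apply]

lemma two_mul_odd_mul_odd (a b : ℕ) :
    2 * ((2 * a + 1) * (2 * b + 1)) - 2 = 4 * (2 * a * b + a + b) := by
  rw [show 2 * ((2 * a + 1) * (2 * b + 1)) = 4 * (2 * a * b + a + b) + 2 by ring,
    Nat.add_sub_cancel]

lemma polyH_eq_smul (g : ℕ) : polyH g = ((-1 / 2 : ℂ) ^ g / (g + 1)) •
    ∑ e ∈ alternating (2 * g + 2), rename e (cycleCofactor (2 * g + 2)) := by
  rw [polyH, C_mul']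

lemma natDegree_pullFrom_polyH_le {g a b : ℕ} (hg : a + b = g) (u : Fin (2 * g + 2) → S) :
    (pullFrom (2 * a + 1) u (polyH g)).natDegree ≤ 4 * (2 * a * b + a + b) := by
  rw [polyH_eq_smul, map_smul, map_sum, ← two_mul_odd_mul_odd]
  refine (Polynomial.natDegree_smul_le _ _).trans
    (Polynomial.natDegree_sum_le_of_forall_le _ _ fun e _ => ?_)
  exact natDegree_pullFrom_le (n := 2 * g + 1) (by omega) (by omega) (by omega) u e

/-- The extremal coefficient of `H_g` as `2b + 1` of the variables move away from the others. The
denominator `g + 1` cancels against the even rotations of an arrangement. -/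
lemma coeff_pullFrom_polyH {g a b : ℕ} (hg : a + b = g)
    (hr : (2 * a + 1) + (2 * b + 1) = 2 * g + 2) (u : Fin (2 * g + 2) → S) :
    (pullFrom (2 * a + 1) u (polyH g)).coeff (4 * (2 * a * b + a + b)) =
      (-1 / 2 : ℂ) ^ g •
        (aeval (fun k => u (Fin.cast hr (Fin.castAdd (2 * b + 1) k))) (pathSum (2 * a + 1)) *
          aeval (fun k => u (Fin.cast hr (Fin.natAdd (2 * a + 1) k))) (pathSum (2 * b + 1))) := by
  rw [polyH_eq_smul, map_smul, map_sum, ← two_mul_odd_mul_odd, Polynomial.coeff_smul,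
    Polynomial.finsetSum_coeff,
    sum_alternating_eq_sum_split hg
      (fun e => (pullFrom (2 * a + 1) u (rename e (cycleCofactor (2 * g + 2)))).coeff
        (2 * ((2 * a + 1) * (2 * b + 1)) - 2))
      (fun e m => by rw [rename_mul_addRight_cycleCofactor])
      (fun e he => descents_of_coeff_ne_zero (n := 2 * g + 1) hr (by omega) (by omega) u e he),
    sum_split_coeff_pullFrom hr ⟨a, rfl⟩ ⟨b, rfl⟩]
  have h1 : ((g : S) + 1) = algebraMap ℂ S (g + 1) := by simp
  have h2 : (g : ℂ) + 1 ≠ 0 := Nat.cast_add_one_ne_zero g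
  rw [h1, ← Algebra.smul_def, smul_smul, div_mul_cancel₀ _ h2]

/-! ### The star map and the Witt map -/

lemma inLast_eq_pullFrom (n : ℕ) :
    inLast n = pullFrom n (Fin.snoc X 0 : Fin (n + 1) → CPoly n) := by
  refine algHom_ext fun i => ?_
  rw [inLast, pullFrom, aeval_X, aeval_X]
  refine Fin.lastCases ?_ (fun k => ?_) i
  · simp
  · simp

lemma pathSum_one : pathSum 1 = 1 := by
  have h1 : alternating 1 = {1} := by decide
  simp [pathSum, h1, pathCofactor, diffProd]

lemma starMap_polyH (g : ℕ) : starMap (polyH g) = (-1 / 2 : ℂ) ^ g • pathSum (2 * g + 1) := by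
  rw [starMap_eq_coeff (polyH_mem_binaryInvariants g), inLast_eq_pullFrom,
    show g * 4 = 4 * (2 * g * 0 + g + 0) by ring]
  have h := coeff_pullFrom_polyH (g := g) (a := g) (b := 0) rfl (by omega)
    (Fin.snoc X 0 : Fin (2 * g + 1 + 1) → CPoly (2 * g + 1))
  refine h.trans ?_
  have h1 : ∀ k : Fin (2 * g + 1), (Fin.snoc X 0 : Fin (2 * g + 1 + 1) → CPoly (2 * g + 1))
      (Fin.cast rfl (Fin.castAdd (2 * 0 + 1) k)) = X k := fun k => Fin.snoc_castSucc _ _ k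
  simp only [h1]
  have h2 : pathSum (2 * 0 + 1) = 1 := pathSum_one
  rw [h2, map_one, mul_one, aeval_X_left_apply]

lemma pullApart_eq_pullFrom {a b r : ℕ} (hr : a + b = r) :
    pullApart a b hr = pullFrom a (fun i => Fin.addCases (motive := fun _ => CPoly a ⊗[ℂ] CPoly b)
      (fun k => X k ⊗ₜ[ℂ] 1) (fun k => 1 ⊗ₜ[ℂ] X k) (Fin.cast hr.symm i)) := by
  subst hr
  refine algHom_ext fun i => ?_
  rw [pullApart, pullFrom, aeval_X, aeval_X]
  refine Fin.addCases (fun k => ?_) (fun k => ?_) i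
  · simp [k.2.not_ge]
  · simp

lemma aeval_tmul_one {a b : ℕ} (p : CPoly a) :
    aeval (fun k => (X k : CPoly a) ⊗ₜ[ℂ] (1 : CPoly b)) p = p ⊗ₜ[ℂ] 1 := by
  have h : aeval (fun k => (X k : CPoly a) ⊗ₜ[ℂ] (1 : CPoly b)) =
      (Algebra.TensorProduct.includeLeft : CPoly a →ₐ[ℂ] CPoly a ⊗[ℂ] CPoly b) :=
    algHom_ext fun k => by simp
  rw [h, Algebra.TensorProduct.includeLeft_apply]

lemma aeval_one_tmul {a b : ℕ} (p : CPoly b) :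
    aeval (fun k => (1 : CPoly a) ⊗ₜ[ℂ] (X k : CPoly b)) p = 1 ⊗ₜ[ℂ] p := by
  have h : aeval (fun k => (1 : CPoly a) ⊗ₜ[ℂ] (X k : CPoly b)) =
      (Algebra.TensorProduct.includeRight : CPoly b →ₐ[ℂ] CPoly a ⊗[ℂ] CPoly b) :=
    algHom_ext fun k => by simp
  rw [h, Algebra.TensorProduct.includeRight_apply]

/-- The extremal coefficient in the definition of the Witt map is the tensor product of the images
under the star map. -/
lemma coeffMap_polyH (a b : ℕ) :
    coeffMap (2 * a + 1) (2 * b + 1) (split_index rfl) (4 * (2 * a * b + a + b)) (polyH (a + b)) =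
      starMap (polyH a) ⊗ₜ[ℂ] starMap (polyH b) := by
  rw [starMap_polyH, starMap_polyH, TensorProduct.smul_tmul_smul, ← pow_add]
  change (pullApart (2 * a + 1) (2 * b + 1) (split_index rfl) (polyH (a + b))).coeff _ = _
  rw [pullApart_eq_pullFrom, coeff_pullFrom_polyH rfl (split_index rfl)]
  congr 1
  simp only [Fin.cast_cast, Fin.cast_eq_self, Fin.addCases_left, Fin.addCases_right]
  rw [aeval_tmul_one, aeval_one_tmul, Algebra.TensorProduct.tmul_mul_tmul, mul_one, one_mul]

lemma polyH_mem_valInvariants (g : ℕ) : polyH g ∈ valInvariants g (g * 4) := by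
  refine ⟨polyH_mem_binaryInvariants g, fun a b hg ha _ => ?_⟩
  have hg0 : (g : ℚ) ≠ 0 := by
    have : g ≠ 0 := by omega
    exact_mod_cast this
  rw [splitVal, pullApart_eq_pullFrom]
  refine (Nat.cast_le.mpr (natDegree_pullFrom_polyH_le hg _)).trans (le_of_eq ?_)
  push_cast
  field_simp

lemma polyH_mem_thetaForms (g : ℕ) : polyH g ∈ thetaForms g 8 :=
  ⟨polyH_mem_valInvariants g, fun _ hσ => rename_polyH hσ⟩

/-- `H_g` as an element of `𝓑_g^8`. -/
def thetaH (g : ℕ) : thetaForms g 8 := ⟨polyH g, polyH_mem_thetaForms g⟩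

lemma starLinear_injective (n w : ℕ) : Function.Injective (starLinear n w) := by
  refine (injective_iff_map_eq_zero _).mpr fun f hf => Subtype.ext (eq_zero_of_coeff f.2 ?_)
  rw [← starMap_eq_coeff f.2]
  exact hf

lemma starTensor_injective (a b j : ℕ) : Function.Injective (starTensor a b j) :=
  TensorProduct.map_injective_of_flat_flat _ _ (starLinear_injective _ _) (starLinear_injective _ _)

lemma isWittImage_thetaH (a b : ℕ) :
    IsWittImage a b (8 / 2) (toValInvariants (thetaH (a + b)))
      (toBinaryInvariants (thetaH a) ⊗ₜ[ℂ] toBinaryInvariants (thetaH b)) :=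
  (coeffMap_polyH a b).symm

lemma isCuspForm_thetaH {g : ℕ} (hg : 1 ≤ g) : IsCuspForm (toBinaryInvariants (thetaH g)) := by
  intro m n hmn
  have h : phiBar m n (toBinaryInvariants (thetaH g) : CPoly (2 * g + 2)) = 0 :=
    phiBar_polyH hg hmn
  rw [phi, h, map_zero, zero_div]

end BinaryInvariants
end

open BinaryInvariants
theorem mainTheorem1 :
    ∃ h : (g : ℕ) → thetaForms g 8,
      (∀ g : ℕ, 1 ≤ g →
        algebraMap (CPoly (2 * g + 2)) (FractionRing (CPoly (2 * g + 2))) (h g) = H g) ∧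
      (h 1 : CPoly (2 * 1 + 2)) =
        disc (Finset.univ : Finset (Fin (2 * 1 + 2))) * disc (oddSet 1) * disc (oddSet 1)ᶜ ∧
      (∀ g₁ g₂ : ℕ, 1 ≤ g₁ → 1 ≤ g₂ →
        (∃! x, IsWittImage g₁ g₂ (8 / 2) (toValInvariants (h (g₁ + g₂))) x) ∧
        wittMap g₁ g₂ (8 / 2) (toValInvariants (h (g₁ + g₂))) =
          toBinaryInvariants (h g₁) ⊗ₜ[ℂ] toBinaryInvariants (h g₂)) ∧
      (∀ g : ℕ, 1 ≤ g →
        ∑ σ : Equiv.Perm (Fin (2 * g + 2)),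
          MvPolynomial.rename σ (h g : CPoly (2 * g + 2)) = 0) ∧
      (∀ g : ℕ, 1 ≤ g → IsCuspForm (toBinaryInvariants (h g))) := by
  refine ⟨thetaH, fun g _ => algebraMap_polyH g, polyH_one, fun g₁ g₂ _ _ => ?_,
    fun g hg => sum_perm_rename_polyH hg, fun g hg => isCuspForm_thetaH hg⟩
  have hunique : ∃! x, IsWittImage g₁ g₂ (8 / 2) (toValInvariants (thetaH (g₁ + g₂))) x :=
    ⟨_, isWittImage_thetaH g₁ g₂, fun y hy =>
      starTensor_injective g₁ g₂ (8 / 2) (hy.trans (isWittImage_thetaH g₁ g₂).symm)⟩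
  refine ⟨hunique, ?_⟩
  rw [wittMap, dif_pos hunique]
  exact hunique.unique hunique.choose_spec.1 (isWittImage_thetaH g₁ g₂)
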